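/- All logarithms are to base $2$. Let $p$ and $q_{\mathbf x}$ ($\mathbf x\in\mathcal X$) be probability densities with respect to a common ($s$-finite) measure $\mu$ on a measurable space $\mathcal Z$, with $(\mathbf x,\mathbf z)\mapsto q_{\mathbf x}(\mathbf z)$ jointly measurable. Let $\mathbf X$ be an $\mathcal X$-valued random variable, let $\mathbf Z_1,\mathbf Z_2,\dots$ be i.i.d. with density $p$, let $S_1,S_2,\dots$ be i.i.d. exponential random variables with rate $1$, and let $\mathbf X$, $(\mathbf Z_n)_n$ and $(S_n)_n$ be independent. Assume that $$C=\mathbb E_{\mathbf X}\big[D_{\mathrm{KL}}(q_{\mathbf X}\,\|\,p)\big]<\infty .$$ For an integer $N\ge 1$ put $$\tilde T_{N,n}=\sum_{m=1}^{n}\frac{N}{N-m+1}\,S_m\quad(1\le n\le N),\qquad N^*_{\mathrm{ORC}}=\operatorname*{argmin}_{1\le n\le N}\ \tilde T_{N,n}\,\frac{p(\mathbf Z_n)}{q_{\mathbf X}(\mathbf Z_n)},$$ where ties are broken in favour of the smaller index and $p(\mathbf z)/q_{\mathbf x}(\mathbf z)=\infty$ if $q_{\mathbf x}(\mathbf z)=0<p(\mathbf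 z)$. Then for every $N\ge 1$ the Shannon entropy of the index satisfies $$H[N^*_{\mathrm{ORC}}]<C+\log(C+1)+4 .$$ Moreover, this bound is achieved by entropy coding the index with a Zipf distribution: with $$p_\lambda(n)=\frac{n^{-\lambda}}{\sum_{k\ge 1}k^{-\lambda}}\quad(n\ge 1),\qquad \lambda=1+\frac{1}{C+e^{-1}\log e+1},$$ the expected ideal code length satisfies $$\mathbb E\big[-\log p_\lambda(N^*_{\mathrm{ORC}})\big]<C+\log(C+1)+4 .$$ -/

import Mathlib

open MeasureTheory ProbabilityTheory
open scoped ENNReal NNReal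

namespace ReverseChannelCoding

/-- Shannon entropy, in bits, of an `ℕ`-valued random variable `K` on `(Ω, P)`. Each term
`-P(K = n) log₂ P(K = n)` is nonnegative, so the sum is taken in `[0, ∞]`. -/
noncomputable def entropyBits {Ω : Type*} [MeasurableSpace Ω] (P : Measure Ω) (K : Ω → ℕ) :
    ℝ≥0∞ :=
  ∑' n : ℕ, ENNReal.ofReal
    (-(P.real {ω | K ω = n} * Real.logb 2 (P.real {ω | K ω = n})))

/-- Kullback-Leibler divergence `D(ν ‖ ρ)` in bits: the divergence in nats divided by `ln 2`. -/
noncomputable def klBits {𝒵 : Type*} [MeasurableSpace 𝒵] (ν ρ : Measure 𝒵) : ℝ≥0∞ :=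
  InformationTheory.klDiv ν ρ / ENNReal.ofReal (Real.log 2)

/-- The Zipf distribution on `{1, 2, …}` with exponent `a`: its mass at `n` is `n ^ (-a)` divided by
`∑ k ≥ 1, k ^ (-a)`. It is a probability distribution for `a > 1`. -/
noncomputable def zipf (a : ℝ) (n : ℕ) : ℝ :=
  (n : ℝ) ^ (-a) / ∑' k : ℕ, ((k : ℝ) + 1) ^ (-a)

/-- Expected ideal code length `E[-log₂ w(K)]`, in bits, of entropy coding the `ℕ`-valued random
variable `K` with the mass function `w`. -/
noncomputable def expectedCodeLength {Ω : Type*} [MeasurableSpace Ω] (P : Measure Ω)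
    (w : ℕ → ℝ) (K : Ω → ℕ) : ℝ≥0∞ :=
  ∫⁻ ω, ENNReal.ofReal (-Real.logb 2 (w (K ω))) ∂P

/-- The weighted partial sum `∑_{m=1}^n N / (N - m + 1) * s m`. -/
noncomputable def orcTime (N : ℕ) (s : ℕ → ℝ) (n : ℕ) : ℝ :=
  ∑ m ∈ Finset.Icc 1 n, (N : ℝ) / ((N : ℝ) - (m : ℝ) + 1) * s m

/-- The score of candidate `n` for the proposal density `p` and the target density `q`. It is
`∞` when `q (z n) = 0`, `p (z n) ≠ 0` and the time is positive. -/
noncomputable def orcScore {𝒵 : Type*} (N : ℕ) (p q : 𝒵 → ℝ≥0∞) (z : ℕ → 𝒵) (s : ℕ → ℝ)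
    (n : ℕ) : ℝ≥0∞ :=
  ENNReal.ofReal (orcTime N s n) * (p (z n) / q (z n))

/-- The index selected by ordered random coding: the smallest minimizer of the score over
`n ∈ {1, …, N}`. -/
noncomputable def orcIndex {𝒵 : Type*} (N : ℕ) (p q : 𝒵 → ℝ≥0∞) (z : ℕ → 𝒵) (s : ℕ → ℝ) : ℕ :=
  sInf {n : ℕ | n ∈ Finset.Icc 1 N ∧
    ∀ m ∈ Finset.Icc 1 N, orcScore N p q z s n ≤ orcScore N p q z s m}

end ReverseChannelCoding

/-! The index is compared with that of the Poisson functional representation, which minimizes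
`arrival n / ρ (Z n)` over infinitely many candidates, `ρ = q / p` being the density ratio. The
weights `N / (N - m + 1)` increase with `m`, so the ratio of `orcTime` to `arrival` is nondecreasing
in the index, and passing to ordered times only handicaps later candidates. Hence the ordered index
never exceeds the Poisson index (`orcIndex_le_of_mem_selected`), whatever `N` is, and the expected
logarithm of the latter is what has to be bounded.

Arrival times and marks form a Poisson process with intensity Lebesgue times `π`. The winner's time
and mark have density `exp (-u / ρ z)`; given these, the number of its predecessors is Poisson with
mean `A ≤ u`. Given the mark `z` the mean of `u` is `ρ z`, so Jensen's inequality yields the bound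
`∫ ρ log (1 + ρ) dπ` for the expected logarithm (`lintegral_log_index_le`).

No point process is constructed. Candidates are integrated out one at a time
(`IsMarkedClock.lintegral_selectedUpTo`) by a Markov step whose iterates are explicit for
predecessors (`thinStep_iterate_exp`) and bounded below for successors (`le_thinStep_iterate_one`).
Lower bounds suffice: they show that a probability law is dominated by the winner's law, of mass at
most one, so the two agree and a winner exists almost surely (`selectedLaw_eq`).

Finally `x log (1 + x) ≤ x log x + x log 2 + 1 / e` bounds the expected binary logarithm by `L = C +
(log₂ e) / e + 1`. A Zipf code with exponent `1 + 1 / L` then costs at most `L + 1 + log₂ (1 + L)`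
bits, and Gibbs' inequality carries this over to the entropy. -/

namespace ReverseChannelCoding

/-! ### Thinned Poisson clocks with a monotone acceptance rate -/

section ThinnedClock

open Set Filter Topology

/-- One step of a rate-one Poisson clock started at `t`, thinned with acceptance probability `H`:
the next arrival time `v` is weighted by `H v * φ v`. -/
noncomputable def thinStep (H : ℝ → ℝ) (φ : ℝ → ℝ≥0∞) (t : ℝ) : ℝ≥0∞ :=
  ∫⁻ v in Ioi t, ENNReal.ofReal (Real.exp (t - v) * H v) * φ v

/-- The cumulative acceptance rate `∫_0^t H`. -/
noncomputable def cumRate (H : ℝ → ℝ) (t : ℝ) : ℝ := ∫ v in (0 : ℝ)..t, H v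

theorem thinStep_mono {H : ℝ → ℝ} {φ ψ : ℝ → ℝ≥0∞} {t : ℝ} (h : ∀ v, t < v → φ v ≤ ψ v) :
    thinStep H φ t ≤ thinStep H ψ t := by
  refine setLIntegral_mono' measurableSet_Ioi fun v hv => ?_
  gcongr
  exact h v hv

/-- A monotone rate may jump at countably many times; its primitive is differentiable at all others,
so the fundamental theorem must tolerate a countable exceptional set. -/
theorem lintegral_Ioc_of_hasDerivAt_off_countable {f f' : ℝ → ℝ} {a b : ℝ} {s : Set ℝ}
    (hab : a ≤ b) (hs : s.Countable) (hf : Continuous f)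
    (hd : ∀ x, x ∉ s → HasDerivAt f (f' x) x) (hi : IntervalIntegrable f' volume a b)
    (h0 : ∀ x ∈ Ioc a b, 0 ≤ f' x) :
    ∫⁻ x in Ioc a b, ENNReal.ofReal (f' x) = ENNReal.ofReal (f b - f a) := by
  rw [← integral_eq_of_hasDerivAt_off_countable f f' hs hf.continuousOn
    (fun x hx => hd x hx.2) hi, intervalIntegral.integral_of_le hab]
  rw [ofReal_integral_eq_lintegral_ofReal hi.1]
  exact (ae_restrict_iff' measurableSet_Ioc).2 (ae_of_all _ h0)

variable {H : ℝ → ℝ}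

theorem cumRate_sub (hH : Monotone H) (a b : ℝ) : cumRate H b - cumRate H a = ∫ v in a..b, H v :=
  intervalIntegral.integral_interval_sub_left hH.intervalIntegrable hH.intervalIntegrable

theorem cumRate_mono (hH : Monotone H) (h0 : ∀ v, 0 ≤ H v) : Monotone (cumRate H) := by
  intro a b hab
  have := cumRate_sub hH a b
  have h2 : 0 ≤ ∫ v in a..b, H v := intervalIntegral.integral_nonneg hab fun v _ => h0 v
  linarith

theorem continuous_cumRate (hH : Monotone H) : Continuous (cumRate H) :=
  intervalIntegral.continuous_primitive (fun _ _ => hH.intervalIntegrable) 0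

theorem hasDerivAt_cumRate (hH : Monotone H) {v : ℝ} (hv : ContinuousAt H v) :
    HasDerivAt (cumRate H) (H v) v :=
  intervalIntegral.integral_hasDerivAt_right hH.intervalIntegrable
    hH.measurable.stronglyMeasurable.stronglyMeasurableAtFilter hv

theorem cumRate_le (hH : Monotone H) (h1 : ∀ v, H v ≤ 1) {t : ℝ} (ht : 0 ≤ t) :
    cumRate H t ≤ t := by
  have : ∫ v in (0 : ℝ)..t, H v ≤ ∫ _ in (0 : ℝ)..t, (1 : ℝ) :=
    intervalIntegral.integral_mono_on ht hH.intervalIntegrable (by simp) fun v _ => h1 v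
  simpa [cumRate] using this

/-- The thinned clock accepts `m` arrivals before the arrival at time `u`. -/
theorem thinStep_iterate_exp (hH : Monotone H) (h0 : ∀ v, 0 ≤ H v) (u : ℝ) (m : ℕ) (t : ℝ) :
    (thinStep H)^[m] (fun v => if v < u then ENNReal.ofReal (Real.exp (v - u)) else 0) t =
      if t < u then ENNReal.ofReal
        (Real.exp (t - u) * ((cumRate H u - cumRate H t) ^ m / m.factorial)) else 0 := by
  induction m generalizing t with
  | zero => simp
  | succ m ih =>
    rw [Function.iterate_succ_apply']
    simp only [funext ih]
    unfold thinStep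
    by_cases htu : t < u
    · rw [if_pos htu]
      have hA := continuous_cumRate hH
      -- The exponentials collapse to the constant `exp (t - u)`, leaving a power of the remaining
      -- cumulative rate times `H`, which has an explicit primitive.
      have key := lintegral_Ioc_of_hasDerivAt_off_countable (a := t) (b := u)
        (f := fun v => -(Real.exp (t - u) *
          ((cumRate H u - cumRate H v) ^ (m + 1) / (m + 1).factorial)))
        (f' := fun v => H v * (Real.exp (t - u) *
          ((cumRate H u - cumRate H v) ^ m / m.factorial))) htu.le
        hH.countable_not_continuousAt (by fun_prop) (fun v hv => ?_) ?_ ?_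
      · rw [show (fun v => -(Real.exp (t - u) *
          ((cumRate H u - cumRate H v) ^ (m + 1) / (m + 1).factorial))) u -
          (fun v => -(Real.exp (t - u) *
          ((cumRate H u - cumRate H v) ^ (m + 1) / (m + 1).factorial))) t =
          Real.exp (t - u) * ((cumRate H u - cumRate H t) ^ (m + 1) / (m + 1).factorial) by
            simp] at key
        rw [← key, Measure.restrict_congr_set (μ := volume) Ioo_ae_eq_Ioc.symm,
          ← lintegral_indicator measurableSet_Ioi, ← lintegral_indicator measurableSet_Ioo]
        congr 1
        ext v
        by_cases h1 : t < v
        · by_cases h2 : v < u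
          · rw [indicator_of_mem (show v ∈ Ioi t from h1),
              indicator_of_mem (show v ∈ Ioo t u from ⟨h1, h2⟩)]
            beta_reduce
            rw [if_pos h2,
              ← ENNReal.ofReal_mul (mul_nonneg (Real.exp_pos _).le (h0 v)),
              show t - u = (t - v) + (v - u) by ring, Real.exp_add]
            congr 1
            ring
          · rw [indicator_of_mem (show v ∈ Ioi t from h1),
              indicator_of_notMem (fun h : v ∈ Ioo t u => h2 h.2)]
            beta_reduce
            rw [if_neg h2, mul_zero]
        · rw [indicator_of_notMem (fun h : v ∈ Ioi t => h1 h),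
            indicator_of_notMem (fun h : v ∈ Ioo t u => h1 h.1)]
      · have hd := hasDerivAt_cumRate hH (not_not.1 hv)
        have := ((((hd.const_sub (cumRate H u)).pow (m + 1)).div_const
          ((m + 1).factorial : ℝ)).const_mul (Real.exp (t - u))).neg
        convert! this using 1
        rw [Nat.factorial_succ]
        push_cast
        have : (m.factorial : ℝ) ≠ 0 := by positivity
        have : (m : ℝ) + 1 ≠ 0 := by positivity
        field_simp
      · exact hH.intervalIntegrable.mul_continuousOn (by fun_prop)
      · intro v hv
        have := cumRate_mono hH h0 hv.2
        have h3 : 0 ≤ cumRate H u - cumRate H v := by linarith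
        have := h0 v
        positivity
    · rw [if_neg htu]
      refine (setLIntegral_congr_fun measurableSet_Ioi (g := fun _ => 0) fun v hv => ?_).trans
        (by simp)
      have : ¬ v < u := fun h => htu (lt_trans hv h)
      simp [this]

/-- If the cumulative rejection rate is bounded by `D`, the probability that `m` arrivals after
time `t` are all accepted is at least the one for infinitely many arrivals. -/
theorem le_thinStep_iterate_one (hH : Monotone H) (h0 : ∀ v, 0 ≤ H v) {D : ℝ}
    (hD : ∀ t, 0 ≤ t → t - cumRate H t ≤ D) (m : ℕ) {t : ℝ} (ht : 0 ≤ t) :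
    ENNReal.ofReal (Real.exp (-D + (t - cumRate H t))) ≤ (thinStep H)^[m] (fun _ => 1) t := by
  induction m generalizing t with
  | zero =>
    have := hD t ht
    simp only [Function.iterate_zero, id]
    rw [ENNReal.ofReal_le_one, Real.exp_le_one_iff]
    linarith
  | succ m ih =>
    rw [Function.iterate_succ_apply']
    refine le_trans ?_ (thinStep_mono fun v hv => ih (ht.trans hv.le))
    unfold thinStep
    have hA := continuous_cumRate hH
    -- The bound reproduces itself under one step up to a boundary term at `R`, because `H * exp
    -- (-A)` is the derivative of `-exp (-A)`, where `A` is the cumulative rate.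
    have key : ∀ R, t ≤ R → ENNReal.ofReal
        (Real.exp (-D + (t - cumRate H t)) - Real.exp (-D + t - cumRate H R)) ≤
        ∫⁻ v in Ioi t, ENNReal.ofReal (Real.exp (t - v) * H v) *
          ENNReal.ofReal (Real.exp (-D + (v - cumRate H v))) := by
      intro R hR
      have := lintegral_Ioc_of_hasDerivAt_off_countable (a := t) (b := R)
        (f := fun v => -Real.exp (-D + t - cumRate H v))
        (f' := fun v => H v * Real.exp (-D + t - cumRate H v)) hR
        hH.countable_not_continuousAt (by fun_prop) (fun v hv => ?_) ?_ ?_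
      · rw [show -D + (t - cumRate H t) = -D + t - cumRate H t by ring,
          show Real.exp (-D + t - cumRate H t) - Real.exp (-D + t - cumRate H R) =
          (-Real.exp (-D + t - cumRate H R)) - (-Real.exp (-D + t - cumRate H t)) by ring, ← this]
        refine (lintegral_mono_set Ioc_subset_Ioi_self).trans (le_of_eq ?_)
        refine lintegral_congr fun v => ?_
        rw [← ENNReal.ofReal_mul (mul_nonneg (Real.exp_pos _).le (h0 v)), mul_right_comm,
          ← Real.exp_add, mul_comm (H v)]
        congr 3
        ring
      · have hd := hasDerivAt_cumRate hH (not_not.1 hv)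
        have := ((hd.const_sub (-D + t)).exp).neg
        convert! this using 1
        ring
      · exact hH.intervalIntegrable.mul_continuousOn (by fun_prop)
      · intro v _
        exact mul_nonneg (h0 v) (Real.exp_pos _).le
    have hlim : Tendsto (fun n : ℕ => ENNReal.ofReal
        (Real.exp (-D + (t - cumRate H t)) - Real.exp (-(n : ℝ)))) atTop
        (𝓝 (ENNReal.ofReal (Real.exp (-D + (t - cumRate H t)) - 0))) := by
      refine ENNReal.tendsto_ofReal (tendsto_const_nhds.sub ?_)
      exact Real.tendsto_exp_neg_atTop_nhds_zero.comp tendsto_natCast_atTop_atTop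
    rw [sub_zero] at hlim
    refine le_of_tendsto' hlim fun n => ?_
    -- Bounded cumulative rejection gives `A (t + n) ≥ t + n - D`, so the boundary term is at most
    -- `exp (-n)`.
    refine le_trans ?_ (key (t + n) (by simp))
    have := hD (t + n) (by positivity)
    gcongr
    linarith

end ThinnedClock

/-! ### Integrating out independent marks and waiting times -/

section MarkedClock

open Set Filter Topology

variable {Ω 𝒵 : Type*} [MeasurableSpace Ω] [MeasurableSpace 𝒵] {P : Measure Ω}
  {π : Measure 𝒵} {Z : ℕ → Ω → 𝒵} {S : ℕ → Ω → ℝ}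

/-- Freezing a sequence at its `n`-th term retains only the past while still producing a full
sequence, to which path functionals can be applied. -/
theorem indepFun_trunc_succ {β : Type*} [MeasurableSpace β] {Y : ℕ → Ω → β}
    (hY : ∀ n, Measurable (Y n)) (hind : iIndepFun Y P) (n : ℕ) :
    IndepFun (fun ω i => Y (min i n) ω) (Y (n + 1)) P := by
  have h := hind.indepFun_finset (Finset.range (n + 1)) {n + 1} (by simp) hY
  let f : (Finset.range (n + 1) → β) → ℕ → β :=
    fun y i => y ⟨min i n, Finset.mem_range.2 (Nat.lt_succ_of_le (min_le_right _ _))⟩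
  let g : (({n + 1} : Finset ℕ) → β) → β := fun y => y ⟨n + 1, Finset.mem_singleton_self _⟩
  have hf : Measurable f := measurable_pi_lambda _ fun i => measurable_pi_apply _
  have hg : Measurable g := measurable_pi_apply _
  exact h.comp hf hg

/-- The candidate sequence and the waiting time sequence of an outcome. -/
def paths (Z : ℕ → Ω → 𝒵) (S : ℕ → Ω → ℝ) (ω : Ω) : (ℕ → 𝒵) × (ℕ → ℝ) :=
  ((fun n => Z n ω), fun n => S n ω)

/-- A functional of paths that only depends on the coordinates up to `n`. -/
def DependsUpTo {β : Type*} (n : ℕ) (f : (ℕ → 𝒵) × (ℕ → ℝ) → β) : Prop :=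
  ∀ w w', (∀ i ≤ n, w.1 i = w'.1 i) → (∀ i ≤ n, w.2 i = w'.2 i) → f w = f w'

/-- The independence structure of candidates `Z n ~ π` and rate-one exponential clocks `S n`. -/
structure IsMarkedClock (P : Measure Ω) (π : Measure 𝒵) (Z : ℕ → Ω → 𝒵) (S : ℕ → Ω → ℝ) :
    Prop where
  measurable_Z : ∀ n, Measurable (Z n)
  map_Z : ∀ n, P.map (Z n) = π
  indep_Z : iIndepFun Z P
  measurable_S : ∀ n, Measurable (S n)
  map_S : ∀ n, P.map (S n) = expMeasure 1
  indep_S : iIndepFun S P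
  indep : IndepFun (fun ω n => Z n ω) (fun ω n => S n ω) P

namespace IsMarkedClock

theorem measurable_paths (h : IsMarkedClock P π Z S) :
    Measurable (paths Z S) :=
  (measurable_pi_lambda _ h.measurable_Z).prodMk (measurable_pi_lambda _ h.measurable_S)

/-- The next mark and waiting time can be integrated out independently of the past. -/
theorem lintegral_next [IsProbabilityMeasure P] (h : IsMarkedClock P π Z S) (n : ℕ)
    {Ψ : ((ℕ → 𝒵) × (ℕ → ℝ)) × (ℝ × 𝒵) → ℝ≥0∞} (hΨ : Measurable Ψ)
    (hdep : ∀ y, DependsUpTo n fun w => Ψ (w, y)) :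
    ∫⁻ ω, Ψ (paths Z S ω, (S (n + 1) ω, Z (n + 1) ω)) ∂P =
      ∫⁻ ω, ∫⁻ s, ∫⁻ z, Ψ (paths Z S ω, (s, z)) ∂π ∂expMeasure 1 ∂P := by
  have hπ : IsProbabilityMeasure π := by
    rw [← h.map_Z 0]; exact Measure.isProbabilityMeasure_map (h.measurable_Z 0).aemeasurable
  have he : IsProbabilityMeasure (expMeasure 1) := isProbabilityMeasure_expMeasure one_pos
  have hZ := h.measurable_Z
  have hS := h.measurable_S
  set Zt : Ω → ℕ → 𝒵 := fun ω i => Z (min i n) ω with hZt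
  set St : Ω → ℕ → ℝ := fun ω i => S (min i n) ω with hSt
  have mZt : Measurable Zt := measurable_pi_lambda _ fun i => hZ _
  have mSt : Measurable St := measurable_pi_lambda _ fun i => hS _
  have hrep : ∀ ω y, Ψ (paths Z S ω, y) = Ψ ((Zt ω, St ω), y) := by
    intro ω y
    apply hdep
    · intro i hi; simp [paths, hZt, hi]
    · intro i hi; simp [paths, hSt, hi]
  simp_rw [hrep]
  -- Marks are independent of waiting times, and in each family the past is independent of the next
  -- term, so the joint law is a fourfold product.
  have hI : IndepFun (fun ω => (Zt ω, Z (n + 1) ω)) (fun ω => (St ω, S (n + 1) ω)) P :=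
    h.indep.comp
      (φ := fun y : ℕ → 𝒵 => ((fun i => y (min i n)), y (n + 1)))
      (ψ := fun y : ℕ → ℝ => ((fun i => y (min i n)), y (n + 1))) (by fun_prop) (by fun_prop)
  have hI2 : IndepFun Zt St P := hI.comp measurable_fst measurable_fst
  have l4 := hI.map_prod_eq_prod_map_map (mZt.prodMk (hZ _)).aemeasurable
    (mSt.prodMk (hS _)).aemeasurable
  rw [(indepFun_trunc_succ hZ h.indep_Z n).map_prod_eq_prod_map_map mZt.aemeasurable
    (hZ _).aemeasurable, (indepFun_trunc_succ hS h.indep_S n).map_prod_eq_prod_map_map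
    mSt.aemeasurable (hS _).aemeasurable, h.map_Z, h.map_S] at l4
  have l2 := hI2.map_prod_eq_prod_map_map mZt.aemeasurable mSt.aemeasurable
  have := Measure.isProbabilityMeasure_map (μ := P) mZt.aemeasurable
  have := Measure.isProbabilityMeasure_map (μ := P) mSt.aemeasurable
  have e1 : ∫⁻ ω, Ψ ((Zt ω, St ω), (S (n + 1) ω, Z (n + 1) ω)) ∂P =
      ∫⁻ y, Ψ ((y.1.1, y.2.1), (y.2.2, y.1.2))
        ∂P.map (fun ω => ((Zt ω, Z (n + 1) ω), (St ω, S (n + 1) ω))) := by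
    rw [lintegral_map (by fun_prop)
      ((mZt.prodMk (hZ _)).prodMk (mSt.prodMk (hS _)))]
  have e2 : ∫⁻ ω, ∫⁻ s, ∫⁻ z, Ψ ((Zt ω, St ω), (s, z)) ∂π ∂expMeasure 1 ∂P =
      ∫⁻ y, ∫⁻ s, ∫⁻ z, Ψ (y, (s, z)) ∂π ∂expMeasure 1 ∂P.map (fun ω => (Zt ω, St ω)) := by
    rw [lintegral_map (by fun_prop) (mZt.prodMk mSt)]
  rw [e1, e2, l4, l2, lintegral_prod _ (by fun_prop), lintegral_prod _ (by fun_prop),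
    lintegral_prod _ (by fun_prop)]
  refine lintegral_congr fun a => ?_
  rw [lintegral_lintegral_swap (by fun_prop), lintegral_prod _ (by fun_prop)]

end IsMarkedClock

/-- The arrival time of the `n`-th candidate. -/
def arrival (s : ℕ → ℝ) (n : ℕ) : ℝ := ∑ m ∈ Finset.Icc 1 n, s m

theorem arrival_succ (s : ℕ → ℝ) (n : ℕ) : arrival s (n + 1) = arrival s n + s (n + 1) := by
  simp [arrival, Finset.sum_Icc_succ_top]

@[fun_prop]
theorem measurable_arrival (n : ℕ) : Measurable fun s : ℕ → ℝ => arrival s n := by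
  unfold arrival; fun_prop

theorem dependsUpTo_arrival {𝒵 : Type*} {n k : ℕ} (h : n ≤ k) :
    DependsUpTo k fun w : (ℕ → 𝒵) × (ℕ → ℝ) => arrival w.2 n := by
  intro w w' _ h2
  refine Finset.sum_congr rfl fun i hi => h2 i ?_
  exact (Finset.mem_Icc.1 hi).2.trans h

/-- Integrate out one arrival of the marked clock at time `t`, weighted by `h` and `φ`. -/
noncomputable def markStep (π : Measure 𝒵) (h : ℝ × 𝒵 → ℝ≥0∞) (φ : ℝ → ℝ≥0∞) (t : ℝ) : ℝ≥0∞ :=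
  ∫⁻ s, ∫⁻ z, h (t + s, z) * φ (t + s) ∂π ∂expMeasure 1

theorem measurable_markStep {γ : Type*} [MeasurableSpace γ] [SFinite π]
    {h : γ × ℝ × 𝒵 → ℝ≥0∞} (hh : Measurable h) {φ : γ × ℝ → ℝ≥0∞} (hφ : Measurable φ) :
    Measurable fun y : γ × ℝ => markStep π (fun x => h (y.1, x)) (fun t => φ (y.1, t)) y.2 := by
  have : IsProbabilityMeasure (expMeasure 1) := isProbabilityMeasure_expMeasure one_pos
  unfold markStep
  fun_prop

/-- Arrivals after the `k`-th are removed from the last one backwards, each removal applying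
`markStep` to `φ`. The parameter `c`, fixed by the first `k` candidates, allows a random score as
threshold. -/
theorem IsMarkedClock.lintegral_iterate [IsProbabilityMeasure P] (hc : IsMarkedClock P π Z S)
    {γ : Type*} [MeasurableSpace γ] (k : ℕ) {Ψ : (ℕ → 𝒵) × (ℕ → ℝ) → ℝ≥0∞} (hΨ : Measurable Ψ)
    (dΨ : DependsUpTo k Ψ) {c : (ℕ → 𝒵) × (ℕ → ℝ) → γ} (mc : Measurable c) (dc : DependsUpTo k c)
    {h : γ × ℝ × 𝒵 → ℝ≥0∞} (hh : Measurable h) (m : ℕ) {φ : γ × ℝ → ℝ≥0∞} (hφ : Measurable φ) :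
    ∫⁻ ω, Ψ (paths Z S ω) * (∏ j ∈ Finset.Ioc k (k + m),
        h (c (paths Z S ω), arrival (S · ω) j, Z j ω)) *
        φ (c (paths Z S ω), arrival (S · ω) (k + m)) ∂P =
      ∫⁻ ω, Ψ (paths Z S ω) * (markStep π fun x => h (c (paths Z S ω), x))^[m]
        (fun t => φ (c (paths Z S ω), t)) (arrival (S · ω) k) ∂P := by
  have hπ : IsProbabilityMeasure π := by
    rw [← hc.map_Z 0]; exact Measure.isProbabilityMeasure_map (hc.measurable_Z 0).aemeasurable
  have he : IsProbabilityMeasure (expMeasure 1) := isProbabilityMeasure_expMeasure one_pos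
  induction m generalizing φ with
  | zero => simp
  | succ m ih =>
    simp only [Function.iterate_succ_apply]
    rw [← ih (φ := fun y => markStep π (fun x => h (y.1, x)) (fun t => φ (y.1, t)) y.2)
      (measurable_markStep hh hφ)]
    have key := hc.lintegral_next (k + m) (Ψ := fun y =>
      Ψ y.1 * (∏ j ∈ Finset.Ioc k (k + m), h (c y.1, arrival y.1.2 j, y.1.1 j)) *
        (h (c y.1, arrival y.1.2 (k + m) + y.2.1, y.2.2) *
        φ (c y.1, arrival y.1.2 (k + m) + y.2.1))) (by fun_prop) ?_
    · convert! key using 1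
      · refine lintegral_congr fun ω => ?_
        rw [← add_assoc, Finset.prod_Ioc_succ_top (by omega : k ≤ k + m), arrival_succ]
        simp only [paths]
        ring
      · refine lintegral_congr fun ω => ?_
        unfold markStep
        simp only [paths]
        rw [← lintegral_const_mul _ (by fun_prop)]
        refine lintegral_congr fun s => ?_
        rw [← lintegral_const_mul _ (by fun_prop)]
    · intro y w w' h1 h2
      have e1 := dΨ w w' (fun i hi => h1 i (by omega)) (fun i hi => h2 i (by omega))
      have e2 := dc w w' (fun i hi => h1 i (by omega)) (fun i hi => h2 i (by omega))
      have e3 := dependsUpTo_arrival (𝒵 := 𝒵) (le_refl (k + m)) w w' h1 h2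
      beta_reduce at e3 ⊢
      rw [e1, e2, e3]
      congr 2
      refine Finset.prod_congr rfl fun j hj => ?_
      have hj := (Finset.mem_Ioc.1 hj).2
      have e4 := dependsUpTo_arrival (𝒵 := 𝒵) hj w w' h1 h2
      beta_reduce at e4
      rw [e4, h1 j hj]

theorem lintegral_expMeasure_add {f : ℝ → ℝ≥0∞} (hf : Measurable f) (t : ℝ) :
    ∫⁻ s, f (t + s) ∂expMeasure 1 = ∫⁻ v in Ioi t, ENNReal.ofReal (Real.exp (t - v)) * f v := by
  have hm : Measurable (exponentialPDF 1) :=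
    (measurable_exponentialPDFReal 1).ennreal_ofReal
  have : expMeasure 1 = volume.withDensity (exponentialPDF 1) := rfl
  rw [this, lintegral_withDensity_eq_lintegral_mul _ hm (by fun_prop),
    ← lintegral_add_left_eq_self (μ := volume) (f := fun s => (exponentialPDF 1 * fun s => f (t + s)) s) (-t),
    ← lintegral_indicator measurableSet_Ioi]
  refine lintegral_congr_ae ?_
  -- The exponential density is positive at `0` while `Ioi t` omits `t`; this single point is null.
  filter_upwards [Measure.ae_ne volume t] with v hv
  simp only [Pi.mul_apply, add_neg_cancel_left]
  by_cases h : t < v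
  · rw [indicator_of_mem (show v ∈ Ioi t from h), exponentialPDF_of_nonneg (by linarith)]
    congr 2
    rw [one_mul]
    congr 1
    ring
  · rw [indicator_of_notMem (fun h' : v ∈ Ioi t => h h'),
      exponentialPDF_of_neg (by linarith [lt_of_le_of_ne (not_lt.1 h) hv]), zero_mul]

/-- The weight `φ` sees only the time, so averaging over the independent mark leaves just the
acceptance probability at that time. -/
theorem markStep_eq_thinStep [IsProbabilityMeasure π] {h : ℝ × 𝒵 → ℝ≥0∞} (hh : Measurable h)
    (h1 : ∀ x, h x ≤ 1) {φ : ℝ → ℝ≥0∞} (hφ : Measurable φ) (t : ℝ) :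
    markStep π h φ t = thinStep (fun v => (∫⁻ z, h (v, z) ∂π).toReal) φ t := by
  have hle : ∀ v, ∫⁻ z, h (v, z) ∂π ≤ 1 := fun v =>
    (lintegral_mono fun z => h1 (v, z)).trans (by simp)
  unfold markStep thinStep
  rw [lintegral_expMeasure_add (f := fun v => ∫⁻ z, h (v, z) * φ v ∂π) (by fun_prop)]
  refine lintegral_congr fun v => ?_
  rw [lintegral_mul_const _ (by fun_prop), ENNReal.ofReal_mul (Real.exp_pos _).le,
    ENNReal.ofReal_toReal ((hle v).trans_lt ENNReal.one_lt_top).ne, mul_assoc]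

theorem measurable_thinStep {H : ℝ → ℝ} (hH : Measurable H) {φ : ℝ → ℝ≥0∞} (hφ : Measurable φ) :
    Measurable (thinStep H φ) := by
  have : thinStep H φ = fun t => ∫⁻ v, (Ioi t).indicator
      (fun v => ENNReal.ofReal (Real.exp (t - v) * H v) * φ v) v := by
    ext t
    rw [lintegral_indicator measurableSet_Ioi]; rfl
  rw [this]
  have hs : MeasurableSet {y : ℝ × ℝ | y.1 < y.2} := measurableSet_lt measurable_fst measurable_snd
  have := (Measurable.indicator (f := fun y : ℝ × ℝ =>
    ENNReal.ofReal (Real.exp (y.1 - y.2) * H y.2) * φ y.2) (by fun_prop) hs).lintegral_prod_right'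
    (ν := volume)
  exact this

theorem markStep_iterate_eq_thinStep [IsProbabilityMeasure π] {h : ℝ × 𝒵 → ℝ≥0∞}
    (hh : Measurable h) (h1 : ∀ x, h x ≤ 1) {φ : ℝ → ℝ≥0∞} (hφ : Measurable φ) (m : ℕ) :
    (markStep π h)^[m] φ = (thinStep fun v => (∫⁻ z, h (v, z) ∂π).toReal)^[m] φ := by
  induction m generalizing φ with
  | zero => simp only [Function.iterate_zero, id]
  | succ m ih =>
    have e : markStep π h φ = thinStep (fun v => (∫⁻ z, h (v, z) ∂π).toReal) φ :=
      funext (markStep_eq_thinStep hh h1 hφ)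
    have hm : Measurable (markStep π h φ) := by
      rw [e]
      exact measurable_thinStep (Measurable.ennreal_toReal (Measurable.lintegral_prod_right' hh)) hφ
    rw [Function.iterate_succ_apply, Function.iterate_succ_apply, ih hm, e]

end MarkedClock

/-! ### Selection among finitely many candidates -/

section Selection

open Set Filter Topology

variable {Ω 𝒵 : Type*} [MeasurableSpace Ω] [MeasurableSpace 𝒵] {P : Measure Ω}
  {π : Measure 𝒵} {Z : ℕ → Ω → 𝒵} {S : ℕ → Ω → ℝ} {ρ : 𝒵 → ℝ}

/-- Indicator that an arrival `(v, z)` has a strictly larger score than the arrival at time `c.1`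
with density ratio `c.2`. -/
noncomputable def beatsStrict (ρ : 𝒵 → ℝ) (y : (ℝ × ℝ) × ℝ × 𝒵) : ℝ≥0∞ :=
  -- Scores are compared after cross-multiplication, so that at positive times a vanishing density
  -- ratio acts as an infinite score.
  {y : (ℝ × ℝ) × ℝ × 𝒵 | y.1.1 * ρ y.2.2 < y.2.1 * y.1.2}.indicator 1 y

/-- Indicator that an arrival `(v, z)` has at least the score of the arrival at time `c.1`
with density ratio `c.2`. -/
noncomputable def beatsWeak (ρ : 𝒵 → ℝ) (y : (ℝ × ℝ) × ℝ × 𝒵) : ℝ≥0∞ :=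
  {y : (ℝ × ℝ) × ℝ × 𝒵 | y.1.1 * ρ y.2.2 ≤ y.2.1 * y.1.2}.indicator 1 y

theorem measurable_beatsStrict (hρ : Measurable ρ) : Measurable (beatsStrict ρ) :=
  measurable_one.indicator (measurableSet_lt (by fun_prop) (by fun_prop))

theorem measurable_beatsWeak (hρ : Measurable ρ) : Measurable (beatsWeak ρ) :=
  measurable_one.indicator (measurableSet_le (by fun_prop) (by fun_prop))

theorem beatsStrict_le_one {𝒵 : Type*} {ρ : 𝒵 → ℝ} (y : (ℝ × ℝ) × ℝ × 𝒵) : beatsStrict ρ y ≤ 1 :=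
  indicator_le_self' (fun _ _ => zero_le) y

theorem beatsWeak_le_one {𝒵 : Type*} {ρ : 𝒵 → ℝ} (y : (ℝ × ℝ) × ℝ × 𝒵) : beatsWeak ρ y ≤ 1 :=
  indicator_le_self' (fun _ _ => zero_le) y

/-- Acceptance rate at time `v` of arrivals that strictly exceed the score `c`. -/
noncomputable def strictRate (π : Measure 𝒵) (ρ : 𝒵 → ℝ) (c : ℝ × ℝ) (v : ℝ) : ℝ :=
  (∫⁻ z, beatsStrict ρ (c, v, z) ∂π).toReal

/-- Acceptance rate at time `v` of arrivals whose score is at least `c`. -/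
noncomputable def weakRate (π : Measure 𝒵) (ρ : 𝒵 → ℝ) (c : ℝ × ℝ) (v : ℝ) : ℝ :=
  (∫⁻ z, beatsWeak ρ (c, v, z) ∂π).toReal

theorem strictRate_eq (hρ : Measurable ρ) (c : ℝ × ℝ) (v : ℝ) :
    strictRate π ρ c v = π.real {z | c.1 * ρ z < v * c.2} := by
  unfold strictRate
  rw [show (fun z => beatsStrict ρ (c, v, z)) = {z | c.1 * ρ z < v * c.2}.indicator 1 from rfl,
    lintegral_indicator_one (measurableSet_lt (by fun_prop) (by fun_prop))]
  rfl

theorem weakRate_eq (hρ : Measurable ρ) (c : ℝ × ℝ) (v : ℝ) :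
    weakRate π ρ c v = π.real {z | c.1 * ρ z ≤ v * c.2} := by
  unfold weakRate
  rw [show (fun z => beatsWeak ρ (c, v, z)) = {z | c.1 * ρ z ≤ v * c.2}.indicator 1 from rfl,
    lintegral_indicator_one (measurableSet_le (by fun_prop) (by fun_prop))]
  rfl

theorem monotone_strictRate [IsProbabilityMeasure π] (hρ : Measurable ρ) {c : ℝ × ℝ}
    (hc : 0 ≤ c.2) : Monotone (strictRate π ρ c) := by
  intro v w hvw
  rw [strictRate_eq hρ, strictRate_eq hρ]
  exact measureReal_mono fun z hz => lt_of_lt_of_le hz (mul_le_mul_of_nonneg_right hvw hc)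

theorem monotone_weakRate [IsProbabilityMeasure π] (hρ : Measurable ρ) {c : ℝ × ℝ}
    (hc : 0 ≤ c.2) : Monotone (weakRate π ρ c) := by
  intro v w hvw
  rw [weakRate_eq hρ, weakRate_eq hρ]
  exact measureReal_mono fun z hz => le_trans hz (mul_le_mul_of_nonneg_right hvw hc)

theorem strictRate_nonneg (c : ℝ × ℝ) (v : ℝ) : 0 ≤ strictRate π ρ c v := ENNReal.toReal_nonneg

theorem weakRate_nonneg (c : ℝ × ℝ) (v : ℝ) : 0 ≤ weakRate π ρ c v := ENNReal.toReal_nonneg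

theorem strictRate_le_one [IsProbabilityMeasure π] (hρ : Measurable ρ) (c : ℝ × ℝ) (v : ℝ) :
    strictRate π ρ c v ≤ 1 := by
  rw [strictRate_eq hρ]; exact measureReal_le_one

/-- Probability that `m` consecutive arrivals after time `t` have at least the score `c`. -/
noncomputable def survival (π : Measure 𝒵) (ρ : 𝒵 → ℝ) (m : ℕ) (c : ℝ × ℝ) (t : ℝ) : ℝ≥0∞ :=
  (markStep π fun x => beatsWeak ρ (c, x))^[m] (fun _ => 1) t

theorem measurable_survival [SFinite π] (hρ : Measurable ρ) (m : ℕ) :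
    Measurable fun y : (ℝ × ℝ) × ℝ => survival π ρ m y.1 y.2 := by
  induction m with
  | zero => exact measurable_const
  | succ m ih =>
    unfold survival at ih ⊢
    simp only [Function.iterate_succ_apply']
    exact measurable_markStep (φ := fun y : (ℝ × ℝ) × ℝ =>
      (markStep π fun x => beatsWeak ρ (y.1, x))^[m] (fun _ => 1) y.2) (measurable_beatsWeak hρ) ih

/-- Candidate `k + 1` strictly beats its predecessors and is not beaten by its next `m`
successors, scores being arrival times divided by density ratios. -/
def selectedUpTo (ρ : 𝒵 → ℝ) (k m : ℕ) : Set ((ℕ → 𝒵) × (ℕ → ℝ)) :=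
  {w | (∀ i ∈ Finset.Ioc 0 k, arrival w.2 (k + 1) * ρ (w.1 i) < arrival w.2 i * ρ (w.1 (k + 1))) ∧
    ∀ j ∈ Finset.Ioc (k + 1) (k + 1 + m),
      arrival w.2 (k + 1) * ρ (w.1 j) ≤ arrival w.2 j * ρ (w.1 (k + 1))}

theorem measurableSet_selectedUpTo (hρ : Measurable ρ) (k m : ℕ) :
    MeasurableSet (selectedUpTo ρ k m) := by
  have h1 : ∀ i : ℕ, Measurable fun w : (ℕ → 𝒵) × (ℕ → ℝ) => ρ (w.1 i) := fun i => by fun_prop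
  have h2 : ∀ i : ℕ, Measurable fun w : (ℕ → 𝒵) × (ℕ → ℝ) => arrival w.2 i := fun i => by fun_prop
  have : selectedUpTo ρ k m =
      (⋂ i ∈ Finset.Ioc 0 k, {w : (ℕ → 𝒵) × (ℕ → ℝ) |
        arrival w.2 (k + 1) * ρ (w.1 i) < arrival w.2 i * ρ (w.1 (k + 1))}) ∩
      ⋂ j ∈ Finset.Ioc (k + 1) (k + 1 + m), {w : (ℕ → 𝒵) × (ℕ → ℝ) |
        arrival w.2 (k + 1) * ρ (w.1 j) ≤ arrival w.2 j * ρ (w.1 (k + 1))} := by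
    ext w
    simp [selectedUpTo]
  rw [this]
  refine MeasurableSet.inter ?_ ?_
  · exact Finset.measurableSet_biInter _ fun i _ =>
      measurableSet_lt ((h2 _).mul (h1 _)) ((h2 _).mul (h1 _))
  · exact Finset.measurableSet_biInter _ fun i _ =>
      measurableSet_le ((h2 _).mul (h1 _)) ((h2 _).mul (h1 _))

theorem indicator_selectedUpTo {𝒵 : Type*} {ρ : 𝒵 → ℝ} (k m : ℕ) (w : (ℕ → 𝒵) × (ℕ → ℝ)) :
    (selectedUpTo ρ k m).indicator (1 : (ℕ → 𝒵) × (ℕ → ℝ) → ℝ≥0∞) w =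
      (∏ i ∈ Finset.Ioc 0 k, beatsStrict ρ ((arrival w.2 (k + 1), ρ (w.1 (k + 1))),
        arrival w.2 i, w.1 i)) *
      ∏ j ∈ Finset.Ioc (k + 1) (k + 1 + m), beatsWeak ρ ((arrival w.2 (k + 1), ρ (w.1 (k + 1))),
        arrival w.2 j, w.1 j) := by
  classical
  unfold beatsStrict beatsWeak
  simp only [indicator_apply, mem_ofPred_eq, Pi.one_apply, Finset.prod_ite_zero,
    Finset.prod_const_one]
  by_cases h1 : ∀ i ∈ Finset.Ioc 0 k,
    arrival w.2 (k + 1) * ρ (w.1 i) < arrival w.2 i * ρ (w.1 (k + 1))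
  · rw [if_pos h1, one_mul]
    exact if_congr (by simp only [selectedUpTo, mem_ofPred_eq]; tauto) rfl rfl
  · rw [if_neg h1, zero_mul, if_neg fun h => h1 h.1]

/-- Joint density, with respect to Lebesgue measure on `(0, ∞)` and `π`, of the arrival time and
mark of candidate `k + 1` on the event that it is selected among `k + 1 + m` candidates. -/
noncomputable def selDensity (π : Measure 𝒵) (ρ : 𝒵 → ℝ) (k m : ℕ) (u r : ℝ) : ℝ≥0∞ :=
  ENNReal.ofReal (Real.exp (-u) * (cumRate (strictRate π ρ (u, r)) u ^ k / k.factorial)) *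
    survival π ρ m (u, r) u

/-- The order of elimination matters: successors go first, their threshold being set by candidate `k
+ 1`; then that candidate's time and mark become integration variables, after which the predecessors
face a deterministic threshold. -/
theorem IsMarkedClock.lintegral_selectedUpTo [IsProbabilityMeasure P]
    (hc : IsMarkedClock P π Z S) (hρ : Measurable ρ) (h0 : ∀ z, 0 ≤ ρ z) (k m : ℕ)
    {G : ℝ × 𝒵 → ℝ≥0∞} (hG : Measurable G) :
    ∫⁻ ω, (selectedUpTo ρ k m).indicator 1 (paths Z S ω) *
        G (arrival (S · ω) (k + 1), Z (k + 1) ω) ∂P =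
      ∫⁻ z, (∫⁻ u in Ioi 0, selDensity π ρ k m u (ρ z) * G (u, z)) ∂π := by
  have hπ : IsProbabilityMeasure π := by
    rw [← hc.map_Z 0]; exact Measure.isProbabilityMeasure_map (hc.measurable_Z 0).aemeasurable
  have he : IsProbabilityMeasure (expMeasure 1) := isProbabilityMeasure_expMeasure one_pos
  have mS := measurable_beatsStrict hρ
  have mW := measurable_beatsWeak hρ
  have mb := measurable_survival (π := π) hρ m
  have mp := hc.measurable_paths
  have mZ := hc.measurable_Z
  have mSS := hc.measurable_S
  have mArr : ∀ i, Measurable fun ω => arrival (S · ω) i := fun i =>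
    (measurable_arrival i).comp (measurable_pi_lambda _ mSS)
  let φ : ℝ × 𝒵 → ℝ≥0∞ := fun y => survival π ρ m (y.1, ρ y.2) y.1 * G y
  have mφ : Measurable φ := by fun_prop
  -- integrate out the successors
  have s1 : ∫⁻ ω, (selectedUpTo ρ k m).indicator 1 (paths Z S ω) *
        G (arrival (S · ω) (k + 1), Z (k + 1) ω) ∂P =
      ∫⁻ ω, (∏ i ∈ Finset.Ioc 0 k, beatsStrict ρ ((arrival (S · ω) (k + 1), ρ (Z (k + 1) ω)),
        arrival (S · ω) i, Z i ω)) * φ (arrival (S · ω) (k + 1), Z (k + 1) ω) ∂P := by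
    have := hc.lintegral_iterate (k + 1)
      (Ψ := fun w => (∏ i ∈ Finset.Ioc 0 k, beatsStrict ρ ((arrival w.2 (k + 1), ρ (w.1 (k + 1))),
        arrival w.2 i, w.1 i)) * G (arrival w.2 (k + 1), w.1 (k + 1))) (by fun_prop) ?_
      (c := fun w => (arrival w.2 (k + 1), ρ (w.1 (k + 1)))) (by fun_prop) ?_
      mW m (φ := fun _ => 1) measurable_const
    · convert! this using 1
      · refine lintegral_congr fun ω => ?_
        rw [indicator_selectedUpTo]
        simp only [paths, mul_one]
        ring
      · refine lintegral_congr fun ω => ?_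
        simp only [paths, φ, survival]
        ring
    · intro w w' h1 h2
      have e : ∀ j ≤ k + 1, arrival w.2 j = arrival w'.2 j := fun j hj =>
        dependsUpTo_arrival hj w w' h1 h2
      beta_reduce
      rw [e _ le_rfl, h1 _ le_rfl]
      congr 1
      refine Finset.prod_congr rfl fun j hj => ?_
      have hj := (Finset.mem_Ioc.1 hj).2
      rw [e j (by omega), h1 j (by omega)]
    · intro w w' h1 h2
      have e : ∀ j ≤ k + 1, arrival w.2 j = arrival w'.2 j := fun j hj =>
        dependsUpTo_arrival hj w w' h1 h2
      beta_reduce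
      rw [e _ le_rfl, h1 _ le_rfl]
  -- integrate out the selected candidate
  have s2 : ∫⁻ ω, (∏ i ∈ Finset.Ioc 0 k, beatsStrict ρ
        ((arrival (S · ω) (k + 1), ρ (Z (k + 1) ω)), arrival (S · ω) i, Z i ω)) *
        φ (arrival (S · ω) (k + 1), Z (k + 1) ω) ∂P =
      ∫⁻ ω, ∫⁻ s, ∫⁻ z, (∏ i ∈ Finset.Ioc 0 k, beatsStrict ρ
        ((arrival (S · ω) k + s, ρ z), arrival (S · ω) i, Z i ω)) *
        φ (arrival (S · ω) k + s, z) ∂π ∂expMeasure 1 ∂P := by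
    have := hc.lintegral_next k (Ψ := fun y => (∏ i ∈ Finset.Ioc 0 k, beatsStrict ρ
        ((arrival y.1.2 k + y.2.1, ρ y.2.2), arrival y.1.2 i, y.1.1 i)) *
        φ (arrival y.1.2 k + y.2.1, y.2.2)) (by fun_prop) ?_
    · simp only [arrival_succ]
      exact this
    · intro y w w' h1 h2
      have e : ∀ j ≤ k, arrival w.2 j = arrival w'.2 j := fun j hj =>
        dependsUpTo_arrival hj w w' h1 h2
      beta_reduce
      rw [e _ le_rfl]
      congr 1
      refine Finset.prod_congr rfl fun j hj => ?_
      have hj := (Finset.mem_Ioc.1 hj).2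
      rw [e j (by omega), h1 j (by omega)]
  -- The density at `u` of the next arrival after time `y.2`: the last waiting time is traded for
  -- the arrival time `u`, so Fubini can fix `u` first.
  let ψ : ℝ × ℝ → ℝ≥0∞ := fun y =>
    if y.2 < y.1 then ENNReal.ofReal (Real.exp (y.2 - y.1)) else 0
  have mψ : Measurable ψ := Measurable.ite (measurableSet_lt measurable_snd measurable_fst)
    (by fun_prop) measurable_const
  have s3 : ∀ z, ∫⁻ ω, ∫⁻ s, (∏ i ∈ Finset.Ioc 0 k, beatsStrict ρ
        ((arrival (S · ω) k + s, ρ z), arrival (S · ω) i, Z i ω)) *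
        φ (arrival (S · ω) k + s, z) ∂expMeasure 1 ∂P =
      ∫⁻ u, φ (u, z) * ∫⁻ ω, (∏ i ∈ Finset.Ioc 0 k, beatsStrict ρ
        ((u, ρ z), arrival (S · ω) i, Z i ω)) * ψ (u, arrival (S · ω) k) ∂P := by
    intro z
    have hm : ∀ u, φ (u, z) * ∫⁻ ω, (∏ i ∈ Finset.Ioc 0 k, beatsStrict ρ
        ((u, ρ z), arrival (S · ω) i, Z i ω)) * ψ (u, arrival (S · ω) k) ∂P =
        ∫⁻ ω, φ (u, z) * ((∏ i ∈ Finset.Ioc 0 k, beatsStrict ρ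
        ((u, ρ z), arrival (S · ω) i, Z i ω)) * ψ (u, arrival (S · ω) k)) ∂P := fun u =>
      (lintegral_const_mul _ (by fun_prop)).symm
    simp_rw [hm]
    rw [lintegral_lintegral_swap (μ := volume) (by fun_prop)]
    refine lintegral_congr fun ω => ?_
    rw [lintegral_expMeasure_add (f := fun v => (∏ i ∈ Finset.Ioc 0 k, beatsStrict ρ
        ((v, ρ z), arrival (S · ω) i, Z i ω)) * φ (v, z)) (by fun_prop),
      ← lintegral_indicator measurableSet_Ioi]
    refine lintegral_congr fun v => ?_
    simp only [indicator_apply, mem_Ioi, ψ]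
    split_ifs
    · ring
    · simp
  have s4 : ∀ u z, ∫⁻ ω, (∏ i ∈ Finset.Ioc 0 k, beatsStrict ρ
        ((u, ρ z), arrival (S · ω) i, Z i ω)) * ψ (u, arrival (S · ω) k) ∂P =
      if 0 < u then ENNReal.ofReal (Real.exp (-u) *
        (cumRate (strictRate π ρ (u, ρ z)) u ^ k / k.factorial)) else 0 := by
    intro u z
    have := hc.lintegral_iterate 0 (Ψ := fun w => 1) measurable_const (fun _ _ _ _ => rfl)
      (c := fun w => (u, ρ z)) measurable_const (fun _ _ _ _ => rfl) mS k
      (φ := fun y => ψ (u, y.2)) (by fun_prop)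
    simp only [zero_add, one_mul] at this
    rw [this, markStep_iterate_eq_thinStep (by fun_prop) (fun _ => beatsStrict_le_one _)
      (by fun_prop)]
    have h2 := thinStep_iterate_exp (H := strictRate π ρ (u, ρ z))
      (monotone_strictRate hρ (h0 z)) (strictRate_nonneg _) u k 0
    have h3 : cumRate (strictRate π ρ (u, ρ z)) 0 = 0 := by simp [cumRate]
    rw [h3, sub_zero, zero_sub] at h2
    simp only [arrival, zero_lt_one, Finset.Icc_eq_empty_of_lt, Finset.sum_empty, lintegral_const,
      measure_univ, mul_one]
    exact h2
  rw [s1, s2]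
  have s5 : ∀ ω, ∫⁻ s, ∫⁻ z, (∏ i ∈ Finset.Ioc 0 k, beatsStrict ρ
        ((arrival (S · ω) k + s, ρ z), arrival (S · ω) i, Z i ω)) *
        φ (arrival (S · ω) k + s, z) ∂π ∂expMeasure 1 =
      ∫⁻ z, ∫⁻ s, (∏ i ∈ Finset.Ioc 0 k, beatsStrict ρ
        ((arrival (S · ω) k + s, ρ z), arrival (S · ω) i, Z i ω)) *
        φ (arrival (S · ω) k + s, z) ∂expMeasure 1 ∂π := fun ω =>
    lintegral_lintegral_swap (by fun_prop)
  simp_rw [s5]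
  rw [lintegral_lintegral_swap (by fun_prop)]
  refine lintegral_congr fun z => ?_
  rw [s3, ← lintegral_indicator measurableSet_Ioi]
  refine lintegral_congr fun u => ?_
  rw [s4]
  simp only [indicator_apply, mem_Ioi, φ, selDensity]
  split_ifs
  · ring
  · simp

end Selection

/-! ### Bounds on the selection density, and the infinite horizon -/

section SelectionLaw

open Set Filter Topology

variable {Ω 𝒵 : Type*} [MeasurableSpace Ω] [MeasurableSpace 𝒵] {P : Measure Ω}
  {π : Measure 𝒵} {Z : ℕ → Ω → 𝒵} {S : ℕ → Ω → ℝ} {ρ : 𝒵 → ℝ}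

/-- The two rates differ only at atoms of the law of `u * ρ / r`, of which there are countably many;
ties are therefore negligible. -/
theorem cumRate_strictRate_eq [IsProbabilityMeasure π] (hρ : Measurable ρ) {u r : ℝ} (hr : 0 < r)
    (t : ℝ) : cumRate (strictRate π ρ (u, r)) t = cumRate (weakRate π ρ (u, r)) t := by
  have hg : Measurable fun z => u * ρ z / r := by fun_prop
  have hc := Measure.countable_meas_level_set_pos (μ := π) hg
  refine intervalIntegral.integral_congr_ae ?_
  filter_upwards [hc.ae_notMem volume] with v hv _
  rw [strictRate_eq hρ, weakRate_eq hρ]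
  refine measureReal_congr ?_
  have h0 : π {z | u * ρ z / r = v} = 0 := by simpa using hv
  filter_upwards [measure_eq_zero_iff_ae_notMem.1 h0] with z hz
  refine propext ⟨fun h => le_of_lt h, fun h => lt_of_le_of_ne h fun h' => hz ?_⟩
  rw [div_eq_iff hr.ne']
  exact h'

/-- By the layer-cake formula the rejection rate integrated over all times is `∫ (u / r) * ρ dπ = u
/ r`. -/
theorem sub_cumRate_weakRate_le [IsProbabilityMeasure π] (hρ : Measurable ρ) (h0 : ∀ z, 0 ≤ ρ z)
    (h1 : ∫⁻ z, ENNReal.ofReal (ρ z) ∂π = 1) {u r : ℝ} (hu : 0 ≤ u) (hr : 0 < r) {t : ℝ}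
    (ht : 0 ≤ t) : t - cumRate (weakRate π ρ (u, r)) t ≤ u / r := by
  have hmono := monotone_weakRate (π := π) hρ (c := (u, r)) hr.le
  have e1 : t - cumRate (weakRate π ρ (u, r)) t =
      ∫ v in (0 : ℝ)..t, (1 - weakRate π ρ (u, r) v) := by
    rw [intervalIntegral.integral_sub (by simp) hmono.intervalIntegrable]
    simp [cumRate]
  have hle : ∀ v, weakRate π ρ (u, r) v ≤ 1 := fun v => by
    rw [weakRate_eq hρ]; exact measureReal_le_one
  rw [e1, ← ENNReal.ofReal_le_ofReal_iff (by positivity), intervalIntegral.integral_of_le ht,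
    ofReal_integral_eq_lintegral_ofReal ((intervalIntegrable_const).sub hmono.intervalIntegrable).1
      (ae_of_all _ fun v => sub_nonneg.2 (hle v))]
  calc ∫⁻ v in Ioc 0 t, ENNReal.ofReal (1 - weakRate π ρ (u, r) v)
      ≤ ∫⁻ v in Ioi 0, ENNReal.ofReal (1 - weakRate π ρ (u, r) v) :=
        lintegral_mono_set Ioc_subset_Ioi_self
    _ = ∫⁻ v in Ioi 0, π {z | v < u / r * ρ z} := by
        refine lintegral_congr fun v => ?_
        have hms : MeasurableSet {z | u * ρ z ≤ v * r} :=
          measurableSet_le (by fun_prop) (by fun_prop)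
        rw [weakRate_eq hρ, ← probReal_compl_eq_one_sub hms, ofReal_measureReal]
        congr 1
        ext z
        simp only [mem_compl_iff, mem_ofPred_eq, not_le]
        rw [div_mul_eq_mul_div, lt_div_iff₀ hr]
    _ = ∫⁻ z, ENNReal.ofReal (u / r * ρ z) ∂π :=
        (lintegral_eq_lintegral_meas_lt π (ae_of_all _ fun z => by have := h0 z; positivity)
          (by fun_prop)).symm
    _ = ENNReal.ofReal (u / r) := by
        simp_rw [ENNReal.ofReal_mul (show 0 ≤ u / r by positivity)]
        rw [lintegral_const_mul _ (by fun_prop), h1, mul_one]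

/-- The part of `exp (-u / r)` that lower-bounds the selection density of candidate `k + 1`. -/
noncomputable def selLower (π : Measure 𝒵) (ρ : 𝒵 → ℝ) (k : ℕ) (u r : ℝ) : ℝ :=
  Real.exp (-(u / r)) * (Real.exp (-cumRate (strictRate π ρ (u, r)) u) *
    (cumRate (strictRate π ρ (u, r)) u ^ k / k.factorial))

theorem cumRate_strictRate_nonneg [IsProbabilityMeasure π] (hρ : Measurable ρ) {u r : ℝ}
    (hu : 0 ≤ u) (hr : 0 ≤ r) : 0 ≤ cumRate (strictRate π ρ (u, r)) u := by
  have := cumRate_mono (monotone_strictRate (π := π) hρ (c := (u, r)) hr) (strictRate_nonneg _) hu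
  simpa [cumRate] using this

theorem selLower_nonneg [IsProbabilityMeasure π] (hρ : Measurable ρ) (k : ℕ) {u r : ℝ}
    (hu : 0 ≤ u) (hr : 0 ≤ r) : 0 ≤ selLower π ρ k u r := by
  have := cumRate_strictRate_nonneg (π := π) hρ hu hr
  unfold selLower; positivity

/-- The factors depending on `k` are Poisson weights, whose sum is one. -/
theorem tsum_selLower [IsProbabilityMeasure π] (hρ : Measurable ρ) {u r : ℝ}
    (hu : 0 ≤ u) (hr : 0 ≤ r) :
    ∑' k, ENNReal.ofReal (selLower π ρ k u r) = ENNReal.ofReal (Real.exp (-(u / r))) := by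
  have h : HasSum (fun k => selLower π ρ k u r) (Real.exp (-(u / r)) *
      (Real.exp (-cumRate (strictRate π ρ (u, r)) u) *
        Real.exp (cumRate (strictRate π ρ (u, r)) u))) := by
    unfold selLower
    have := NormedSpace.expSeries_div_hasSum_exp (cumRate (strictRate π ρ (u, r)) u)
    rw [← Real.exp_eq_exp_ℝ] at this
    exact (this.mul_left _).mul_left _
  rw [← Real.exp_add, neg_add_cancel, Real.exp_zero, mul_one] at h
  rw [← ENNReal.ofReal_tsum_of_nonneg (fun k => selLower_nonneg hρ k hu hr) h.summable, h.tsum_eq]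

/-- The survival bound contributes `exp u`, which cancels the `exp (-u)` of the density, and `exp
(-A)`, which completes the Poisson weight since weak and strict cumulative rates agree. -/
theorem selLower_le_selDensity [IsProbabilityMeasure π] (hρ : Measurable ρ) (h0 : ∀ z, 0 ≤ ρ z)
    (h1 : ∫⁻ z, ENNReal.ofReal (ρ z) ∂π = 1) (k m : ℕ) {u r : ℝ} (hu : 0 < u) (hr : 0 < r) :
    ENNReal.ofReal (selLower π ρ k u r) ≤ selDensity π ρ k m u r := by
  have hA := cumRate_strictRate_nonneg (π := π) hρ hu.le hr.le
  have hs : ENNReal.ofReal (Real.exp (-(u / r) + (u - cumRate (weakRate π ρ (u, r)) u))) ≤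
      survival π ρ m (u, r) u := by
    unfold survival
    have hm : Measurable fun x => beatsWeak ρ ((u, r), x) :=
      (measurable_beatsWeak hρ).comp measurable_prodMk_left
    rw [markStep_iterate_eq_thinStep hm (fun _ => beatsWeak_le_one _) measurable_const]
    exact le_thinStep_iterate_one (monotone_weakRate hρ (c := (u, r)) hr.le) (weakRate_nonneg _)
      (fun t ht => sub_cumRate_weakRate_le hρ h0 h1 hu.le hr ht) m hu.le
  unfold selDensity
  refine le_trans (le_of_eq ?_) (mul_le_mul_right hs _)
  rw [← ENNReal.ofReal_mul (by positivity), ← cumRate_strictRate_eq hρ hr, Real.exp_add,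
    sub_eq_add_neg, Real.exp_add]
  unfold selLower
  congr 1
  have : Real.exp (-u) * Real.exp u = 1 := by rw [← Real.exp_add]; simp
  linear_combination (-(Real.exp (-(u / r)) * (Real.exp (-cumRate (strictRate π ρ (u, r)) u) *
    (cumRate (strictRate π ρ (u, r)) u ^ k / k.factorial)))) * this

/-- This is the Poisson recursion `(k + 1) * A ^ (k + 1) / (k + 1)! = A * A ^ k / k!` together with
`A ≤ u`. -/
theorem selDensity_succ_le [IsProbabilityMeasure π] (hρ : Measurable ρ) (k m : ℕ) {u r : ℝ}
    (hu : 0 < u) (hr : 0 ≤ r) :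
    ((k + 1 : ℕ) : ℝ≥0∞) * selDensity π ρ (k + 1) m u r ≤
      ENNReal.ofReal u * selDensity π ρ k m u r := by
  have hA := cumRate_strictRate_nonneg (π := π) hρ hu.le hr
  have hAu := cumRate_le (monotone_strictRate (π := π) hρ (c := (u, r)) hr)
    (strictRate_le_one hρ _) hu.le
  unfold selDensity
  rw [← mul_assoc, ← mul_assoc, ← ENNReal.ofReal_natCast, ← ENNReal.ofReal_mul (by positivity),
    ← ENNReal.ofReal_mul hu.le]
  refine mul_le_mul_left (ENNReal.ofReal_le_ofReal ?_) _
  rw [Nat.factorial_succ, pow_succ]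
  push_cast
  have e : ((k : ℝ) + 1) * (Real.exp (-u) * (cumRate (strictRate π ρ (u, r)) u ^ k *
      cumRate (strictRate π ρ (u, r)) u / (((k : ℝ) + 1) * k.factorial))) =
      cumRate (strictRate π ρ (u, r)) u * (Real.exp (-u) *
        (cumRate (strictRate π ρ (u, r)) u ^ k / k.factorial)) := by
    field_simp
  rw [e]
  gcongr

theorem lintegral_exp_neg_div {r : ℝ} (hr : 0 < r) :
    ∫⁻ u in Ioi 0, ENNReal.ofReal (Real.exp (-(u / r))) = ENNReal.ofReal r := by
  have h := Real.integral_rpow_mul_exp_neg_mul_Ioi one_pos (inv_pos.2 hr)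
  have e : ∀ u : ℝ, u ^ ((1 : ℝ) - 1) * Real.exp (-(r⁻¹ * u)) = Real.exp (-(u / r)) := fun u => by
    rw [sub_self, Real.rpow_zero, one_mul, div_eq_inv_mul]
  simp only [e, Real.Gamma_one, one_div, inv_inv, Real.rpow_one, mul_one] at h
  refine Eq.trans ?_ (congrArg ENNReal.ofReal h)
  rw [ofReal_integral_eq_lintegral_ofReal
    (Integrable.of_integral_ne_zero (by rw [h]; exact hr.ne'))
    (ae_of_all _ fun u => (Real.exp_pos _).le)]

theorem lintegral_mul_exp_neg_div {r : ℝ} (hr : 0 < r) :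
    ∫⁻ u in Ioi 0, ENNReal.ofReal u * ENNReal.ofReal (Real.exp (-(u / r))) =
      ENNReal.ofReal (r ^ 2) := by
  have h := Real.integral_rpow_mul_exp_neg_mul_Ioi two_pos (inv_pos.2 hr)
  have e : ∀ u : ℝ, u ^ ((2 : ℝ) - 1) * Real.exp (-(r⁻¹ * u)) = u * Real.exp (-(u / r)) :=
    fun u => by
      rw [show (2 : ℝ) - 1 = 1 by norm_num, Real.rpow_one, div_eq_inv_mul]
  simp only [e, Real.Gamma_two, one_div, inv_inv, Real.rpow_two, mul_one] at h
  refine Eq.trans ?_ (congrArg ENNReal.ofReal h)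
  rw [ofReal_integral_eq_lintegral_ofReal
    (Integrable.of_integral_ne_zero (by rw [h]; positivity))]
  · exact setLIntegral_congr_fun measurableSet_Ioi fun u hu =>
      (ENNReal.ofReal_mul (le_of_lt hu)).symm
  · filter_upwards [self_mem_ae_restrict measurableSet_Ioi] with u hu
    exact mul_nonneg (le_of_lt hu) (Real.exp_pos _).le

/-- Candidate `k + 1` is the first minimizer of arrival time divided by density ratio. -/
def selected (ρ : 𝒵 → ℝ) (k : ℕ) : Set ((ℕ → 𝒵) × (ℕ → ℝ)) := ⋂ m, selectedUpTo ρ k m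

theorem measurableSet_selected (hρ : Measurable ρ) (k : ℕ) : MeasurableSet (selected ρ k) :=
  MeasurableSet.iInter fun m => measurableSet_selectedUpTo hρ k m

theorem mem_selected {𝒵 : Type*} {ρ : 𝒵 → ℝ} {k : ℕ} {w : (ℕ → 𝒵) × (ℕ → ℝ)} :
    w ∈ selected ρ k ↔
      (∀ i ∈ Finset.Ioc 0 k, arrival w.2 (k + 1) * ρ (w.1 i) < arrival w.2 i * ρ (w.1 (k + 1))) ∧
      ∀ j, k + 1 < j → arrival w.2 (k + 1) * ρ (w.1 j) ≤ arrival w.2 j * ρ (w.1 (k + 1)) := by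
  simp only [selected, selectedUpTo, mem_iInter, mem_ofPred_eq, Finset.mem_Ioc]
  constructor
  · intro h
    refine ⟨(h 0).1, fun j hj => (h j).2 j ⟨hj, by omega⟩⟩
  · intro h m
    exact ⟨h.1, fun j hj => h.2 j hj.1⟩

theorem pairwise_disjoint_selected {𝒵 : Type*} {ρ : 𝒵 → ℝ} :
    Pairwise (Function.onFun Disjoint (selected ρ)) := by
  have key : ∀ k l, k < l → Disjoint (selected ρ k) (selected ρ l) := by
    intro k l hkl
    rw [Set.disjoint_left]
    intro w hk hl
    have h1 := (mem_selected.1 hk).2 (l + 1) (by omega)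
    have h2 := (mem_selected.1 hl).1 (k + 1) (Finset.mem_Ioc.2 ⟨by omega, by omega⟩)
    linarith
  intro k l hkl
  rcases lt_or_gt_of_ne hkl with h | h
  · exact key k l h
  · exact (key l k h).symm

theorem selectedUpTo_antitone {𝒵 : Type*} (ρ : 𝒵 → ℝ) (k : ℕ) :
    Antitone (selectedUpTo ρ k) := by
  intro m m' hm w hw
  refine ⟨hw.1, fun j hj => hw.2 j ?_⟩
  rw [Finset.mem_Ioc] at hj ⊢
  omega

namespace IsMarkedClock

theorem isProbabilityMeasure_mark [IsProbabilityMeasure P] (hc : IsMarkedClock P π Z S) :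
    IsProbabilityMeasure π := by
  rw [← hc.map_Z 0]; exact Measure.isProbabilityMeasure_map (hc.measurable_Z 0).aemeasurable

theorem measurable_arrival (hc : IsMarkedClock P π Z S) (i : ℕ) :
    Measurable fun ω => arrival (S · ω) i :=
  (ReverseChannelCoding.measurable_arrival i).comp (measurable_pi_lambda _ hc.measurable_S)

theorem lintegral_arrival_lt_top (hc : IsMarkedClock P π Z S) (n : ℕ) :
    ∫⁻ ω, ENNReal.ofReal (arrival (S · ω) n) ∂P < ∞ := by
  have h1 : ∀ m, ∫⁻ ω, ENNReal.ofReal (S m ω) ∂P = 1 := by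
    intro m
    rw [← lintegral_map (f := ENNReal.ofReal) (by fun_prop) (hc.measurable_S m), hc.map_S]
    have := lintegral_expMeasure_add (f := ENNReal.ofReal) (by fun_prop) 0
    simp only [zero_add, zero_sub] at this
    rw [this]
    have := lintegral_mul_exp_neg_div one_pos
    simpa [mul_comm] using this
  calc ∫⁻ ω, ENNReal.ofReal (arrival (S · ω) n) ∂P
      ≤ ∫⁻ ω, ∑ m ∈ Finset.Icc 1 n, ENNReal.ofReal (S m ω) ∂P := by
        refine lintegral_mono fun ω => ?_
        exact Finset.le_sum_of_subadditive _ ENNReal.ofReal_zero.le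
          (fun _ _ => ENNReal.ofReal_add_le) _ _
    _ = ∑ m ∈ Finset.Icc 1 n, 1 := by
        rw [lintegral_finsetSum _ fun m _ => (hc.measurable_S m).ennreal_ofReal]
        exact Finset.sum_congr rfl fun m _ => h1 m
    _ < ∞ := by simp

/-- Integrals over the selection event are bounded below through finite horizons. -/
theorem le_setLIntegral_selected [IsProbabilityMeasure P] (hc : IsMarkedClock P π Z S)
    (hρ : Measurable ρ) (h0 : ∀ z, 0 ≤ ρ z) (k : ℕ) {G : ℝ × 𝒵 → ℝ≥0∞} (hG : Measurable G)
    (hfin : ∫⁻ ω, G (arrival (S · ω) (k + 1), Z (k + 1) ω) ∂P ≠ ∞) {x : ℝ≥0∞}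
    (hx : ∀ m, x ≤ ∫⁻ z, (∫⁻ u in Ioi 0, selDensity π ρ k m u (ρ z) * G (u, z)) ∂π) :
    x ≤ ∫⁻ ω, (selected ρ k).indicator 1 (paths Z S ω) *
        G (arrival (S · ω) (k + 1), Z (k + 1) ω) ∂P := by
  have mA := hc.measurable_arrival (k + 1)
  have mZ := hc.measurable_Z (k + 1)
  have mI : ∀ m, Measurable fun ω =>
      (selectedUpTo ρ k m).indicator (1 : (ℕ → 𝒵) × (ℕ → ℝ) → ℝ≥0∞) (paths Z S ω) := fun m =>
    (measurable_one.indicator (measurableSet_selectedUpTo hρ k m)).comp hc.measurable_paths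
  calc x ≤ ⨅ m, ∫⁻ ω, (selectedUpTo ρ k m).indicator 1 (paths Z S ω) *
        G (arrival (S · ω) (k + 1), Z (k + 1) ω) ∂P :=
        le_iInf fun m => (hx m).trans (hc.lintegral_selectedUpTo hρ h0 k m hG).ge
    _ = ∫⁻ ω, ⨅ m, (selectedUpTo ρ k m).indicator 1 (paths Z S ω) *
        G (arrival (S · ω) (k + 1), Z (k + 1) ω) ∂P := by
        refine (lintegral_iInf (fun m => (mI m).mul (by fun_prop)) ?_ ?_).symm
        · intro m m' hm ω
          exact mul_le_mul_left (indicator_le_indicator_of_subset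
            (f := (1 : (ℕ → 𝒵) × (ℕ → ℝ) → ℝ≥0∞)) (selectedUpTo_antitone ρ k hm)
            (fun _ => zero_le) _) _
        · refine ne_top_of_le_ne_top hfin (lintegral_mono fun ω => ?_)
          refine mul_le_of_le_one_left zero_le ?_
          exact indicator_le_self' (fun _ _ => zero_le) _
    _ ≤ _ := by
        refine lintegral_mono fun ω => ?_
        by_cases h : paths Z S ω ∈ selected ρ k
        · rw [indicator_of_mem h]
          refine (iInf_le _ 0).trans (mul_le_mul_left ?_ _)
          exact indicator_le_self' (f := (1 : (ℕ → 𝒵) × (ℕ → ℝ) → ℝ≥0∞)) (fun _ _ => zero_le) _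
        · obtain ⟨m, hm⟩ : ∃ m, paths Z S ω ∉ selectedUpTo ρ k m := by
            simpa [selected] using h
          refine (iInf_le _ m).trans ?_
          rw [indicator_of_notMem hm, zero_mul]
          exact zero_le

/-- The expected number of predecessors of the selected candidate is at most its arrival time. -/
theorem succ_mul_lintegral_selected_le [IsProbabilityMeasure P] (hc : IsMarkedClock P π Z S)
    (hρ : Measurable ρ) (h0 : ∀ z, 0 ≤ ρ z) (k : ℕ) {G : 𝒵 → ℝ≥0∞} (hG : Measurable G)
    (hG1 : ∀ z, G z ≤ 1) :
    ((k + 1 : ℕ) : ℝ≥0∞) * ∫⁻ ω, (selected ρ (k + 1)).indicator 1 (paths Z S ω) *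
        G (Z (k + 2) ω) ∂P ≤
      ∫⁻ ω, (selected ρ k).indicator 1 (paths Z S ω) *
        (ENNReal.ofReal (arrival (S · ω) (k + 1)) * G (Z (k + 1) ω)) ∂P := by
  have := hc.isProbabilityMeasure_mark
  refine hc.le_setLIntegral_selected hρ h0 k (G := fun y => ENNReal.ofReal y.1 * G y.2)
    (by fun_prop) ?_ fun m => ?_
  · refine ne_top_of_le_ne_top (hc.lintegral_arrival_lt_top (k + 1)).ne
      (lintegral_mono fun ω => ?_)
    exact mul_le_of_le_one_right zero_le (hG1 _)
  -- Relaxing the left-hand event to `m` successors gives both densities the same survival factor.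
  · have h2 : ∫⁻ ω, (selected ρ (k + 1)).indicator 1 (paths Z S ω) * G (Z (k + 2) ω) ∂P ≤
        ∫⁻ z, (∫⁻ u in Ioi 0, selDensity π ρ (k + 1) m u (ρ z) * G z) ∂π := by
      rw [← hc.lintegral_selectedUpTo hρ h0 (k + 1) m (G := fun y => G y.2) (by fun_prop)]
      refine lintegral_mono fun ω => ?_
      exact mul_le_mul_left (indicator_le_indicator_of_subset (iInter_subset _ m)
        (fun _ => zero_le) _) _
    refine (mul_le_mul_right h2 _).trans ?_
    rw [← lintegral_const_mul' _ _ (by simp)]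
    refine lintegral_mono fun z => ?_
    rw [← lintegral_const_mul' _ _ (by simp)]
    refine setLIntegral_mono' measurableSet_Ioi fun u hu => ?_
    rw [← mul_assoc, ← mul_assoc, mul_comm (selDensity π ρ k m u (ρ z))]
    exact mul_le_mul_left (selDensity_succ_le hρ k m hu (h0 z)) _

/-- The law of arrival time and mark of the selected candidate. -/
noncomputable def selectedLaw (P : Measure Ω) (Z : ℕ → Ω → 𝒵) (S : ℕ → Ω → ℝ) (ρ : 𝒵 → ℝ) :
    Measure (ℝ × 𝒵) :=
  Measure.sum fun k => (P.restrict (paths Z S ⁻¹' selected ρ k)).map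
    fun ω => (arrival (S · ω) (k + 1), Z (k + 1) ω)

end IsMarkedClock

/-- The density of arrival time and mark of the selected candidate. -/
noncomputable def targetDensity (ρ : 𝒵 → ℝ) (y : ℝ × 𝒵) : ℝ≥0∞ :=
  {y : ℝ × 𝒵 | 0 < ρ y.2}.indicator (fun y => ENNReal.ofReal (Real.exp (-(y.1 / ρ y.2)))) y

end SelectionLaw

/-! ### Law of the winner and expected logarithm of its index -/

section IndexBound

open Set Filter Topology

variable {Ω 𝒵 : Type*} [MeasurableSpace Ω] [MeasurableSpace 𝒵] {P : Measure Ω}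
  {π : Measure 𝒵} {Z : ℕ → Ω → 𝒵} {S : ℕ → Ω → ℝ} {ρ : 𝒵 → ℝ}

theorem measurable_targetDensity (hρ : Measurable ρ) : Measurable (targetDensity ρ) :=
  Measurable.indicator (by fun_prop) (measurableSet_lt measurable_const (by fun_prop))

theorem targetDensity_of_pos {𝒵 : Type*} {ρ : 𝒵 → ℝ} {z : 𝒵} (hz : 0 < ρ z) (u : ℝ) :
    targetDensity ρ (u, z) = ENNReal.ofReal (Real.exp (-(u / ρ z))) :=
  indicator_of_mem (show (u, z) ∈ {y : ℝ × 𝒵 | 0 < ρ y.2} from hz) _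

theorem targetDensity_of_not_pos {𝒵 : Type*} {ρ : 𝒵 → ℝ} {z : 𝒵} (hz : ¬ 0 < ρ z) (u : ℝ) :
    targetDensity ρ (u, z) = 0 :=
  indicator_of_notMem (fun h : (u, z) ∈ {y : ℝ × 𝒵 | 0 < ρ y.2} => hz h) _

/-- The law with density `targetDensity`. -/
noncomputable def targetLaw (π : Measure 𝒵) (ρ : 𝒵 → ℝ) : Measure (ℝ × 𝒵) :=
  ((volume.restrict (Ioi 0)).prod π).withDensity (targetDensity ρ)

theorem lintegral_targetLaw [SFinite π] (hρ : Measurable ρ) {F : ℝ × 𝒵 → ℝ≥0∞}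
    (hF : Measurable F) :
    ∫⁻ y, F y ∂targetLaw π ρ =
      ∫⁻ z, (∫⁻ u in Ioi 0, targetDensity ρ (u, z) * F (u, z)) ∂π := by
  have := measurable_targetDensity hρ
  rw [targetLaw, lintegral_withDensity_eq_lintegral_mul _ this hF,
    lintegral_prod_symm _ (by fun_prop)]
  rfl

/-- Integrating `exp (-u / r)` over positive `u` gives `r`: the mark has density `ρ` under `π`. -/
theorem lintegral_targetLaw_mark [SFinite π] (hρ : Measurable ρ) (h0 : ∀ z, 0 ≤ ρ z)
    {f : 𝒵 → ℝ≥0∞} (hf : Measurable f) :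
    ∫⁻ y, f y.2 ∂targetLaw π ρ = ∫⁻ z, ENNReal.ofReal (ρ z) * f z ∂π := by
  have hd := measurable_targetDensity hρ
  rw [lintegral_targetLaw hρ (by fun_prop)]
  refine lintegral_congr fun z => ?_
  rw [lintegral_mul_const (f z) (by fun_prop)]
  congr 1
  by_cases hz : 0 < ρ z
  · simp_rw [targetDensity_of_pos hz]
    exact lintegral_exp_neg_div hz
  · simp [targetDensity_of_not_pos hz, le_antisymm (not_lt.1 hz) (h0 z)]

/-- Given the mark, the time is exponential with mean `ρ z`, whence the second factor `ρ z`. -/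
theorem lintegral_targetLaw_time_mark [SFinite π] (hρ : Measurable ρ) (h0 : ∀ z, 0 ≤ ρ z)
    {f : 𝒵 → ℝ≥0∞} (hf : Measurable f) :
    ∫⁻ y, ENNReal.ofReal y.1 * f y.2 ∂targetLaw π ρ =
      ∫⁻ z, ENNReal.ofReal (ρ z) * (ENNReal.ofReal (ρ z) * f z) ∂π := by
  have hd := measurable_targetDensity hρ
  rw [lintegral_targetLaw hρ (by fun_prop)]
  refine lintegral_congr fun z => ?_
  simp_rw [← mul_assoc (targetDensity ρ _)]
  rw [lintegral_mul_const _ (by fun_prop), ← mul_assoc]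
  congr 1
  by_cases hz : 0 < ρ z
  · rw [← ENNReal.ofReal_mul hz.le, ← pow_two, ← lintegral_mul_exp_neg_div hz]
    refine lintegral_congr fun u => ?_
    rw [targetDensity_of_pos hz, mul_comm]
  · simp [targetDensity_of_not_pos hz, le_antisymm (not_lt.1 hz) (h0 z)]

/-- The upper limit varies with `c`, so the interval integral is rewritten as a difference of
full-line integrals of indicators of measurable sets. -/
theorem measurable_cumRate_strictRate [SFinite π] (hρ : Measurable ρ) :
    Measurable fun c : ℝ × ℝ => cumRate (strictRate π ρ c) c.1 := by
  have hr : Measurable fun y : (ℝ × ℝ) × ℝ => strictRate π ρ y.1 y.2 := by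
    have := measurable_beatsStrict hρ
    unfold strictRate
    fun_prop
  have hI : ∀ {B : Set ((ℝ × ℝ) × ℝ)}, MeasurableSet B →
      Measurable fun c : ℝ × ℝ => ∫ v, B.indicator (fun y => strictRate π ρ y.1 y.2) (c, v) :=
    fun hB => ((hr.indicator hB).stronglyMeasurable.integral_prod_right'
      (ν := volume)).measurable
  have h1 : MeasurableSet {y : (ℝ × ℝ) × ℝ | 0 < y.2 ∧ y.2 ≤ y.1.1} :=
    (measurableSet_lt measurable_const measurable_snd).inter
      (measurableSet_le measurable_snd (by fun_prop))
  have h2 : MeasurableSet {y : (ℝ × ℝ) × ℝ | y.1.1 < y.2 ∧ y.2 ≤ 0} :=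
    (measurableSet_lt (by fun_prop) measurable_snd).inter
      (measurableSet_le measurable_snd measurable_const)
  convert! (hI h1).sub (hI h2) using 1
  ext c
  rw [cumRate, intervalIntegral, ← integral_indicator measurableSet_Ioc,
    ← integral_indicator measurableSet_Ioc]
  rfl

theorem measurable_selLower [SFinite π] (hρ : Measurable ρ) (k : ℕ) :
    Measurable fun y : ℝ × 𝒵 => selLower π ρ k y.1 (ρ y.2) := by
  have h := (measurable_cumRate_strictRate (π := π) hρ).comp
    (g := fun c : ℝ × ℝ => cumRate (strictRate π ρ c) c.1)
    (f := fun y : ℝ × 𝒵 => (y.1, ρ y.2)) (by fun_prop)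
  simp only [Function.comp_def] at h
  unfold selLower
  fun_prop

namespace IsMarkedClock

theorem measurable_selectedIndicator (hc : IsMarkedClock P π Z S) (hρ : Measurable ρ) (k : ℕ) :
    Measurable fun ω =>
      (selected ρ k).indicator (1 : (ℕ → 𝒵) × (ℕ → ℝ) → ℝ≥0∞) (paths Z S ω) :=
  (measurable_one.indicator (measurableSet_selected hρ k)).comp hc.measurable_paths

theorem setLIntegral_selected (hc : IsMarkedClock P π Z S) (hρ : Measurable ρ) (k : ℕ)
    (f : Ω → ℝ≥0∞) :
    ∫⁻ ω in paths Z S ⁻¹' selected ρ k, f ω ∂P =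
      ∫⁻ ω, (selected ρ k).indicator 1 (paths Z S ω) * f ω ∂P := by
  rw [← lintegral_indicator (hc.measurable_paths (measurableSet_selected hρ k))]
  refine lintegral_congr fun ω => ?_
  by_cases h : paths Z S ω ∈ selected ρ k
  · rw [indicator_of_mem h, indicator_of_mem (show ω ∈ paths Z S ⁻¹' selected ρ k from h)]
    simp
  · rw [indicator_of_notMem h,
      indicator_of_notMem (fun h' : ω ∈ paths Z S ⁻¹' selected ρ k => h h')]
    simp

theorem lintegral_selectedLaw (hc : IsMarkedClock P π Z S) (hρ : Measurable ρ)
    {F : ℝ × 𝒵 → ℝ≥0∞} (hF : Measurable F) :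
    ∫⁻ y, F y ∂selectedLaw P Z S ρ =
      ∑' k, ∫⁻ ω, (selected ρ k).indicator 1 (paths Z S ω) *
        F (arrival (S · ω) (k + 1), Z (k + 1) ω) ∂P := by
  rw [selectedLaw, lintegral_sum_measure]
  refine tsum_congr fun k => ?_
  rw [lintegral_map hF ((hc.measurable_arrival _).prodMk (hc.measurable_Z _)),
    hc.setLIntegral_selected hρ]

/-- The lower bounds `selLower` do not involve the horizon, so they survive the limit, and their sum
over `k` is the target density. -/
theorem targetLaw_le_selectedLaw [IsProbabilityMeasure P] (hc : IsMarkedClock P π Z S)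
    (hρ : Measurable ρ) (h0 : ∀ z, 0 ≤ ρ z) (h1 : ∫⁻ z, ENNReal.ofReal (ρ z) ∂π = 1) :
    targetLaw π ρ ≤ selectedLaw P Z S ρ := by
  have := hc.isProbabilityMeasure_mark
  refine Measure.le_iff.2 fun B hB => ?_
  have hBm : Measurable (B.indicator (1 : ℝ × 𝒵 → ℝ≥0∞)) := measurable_one.indicator hB
  rw [← lintegral_indicator_one hB, ← lintegral_indicator_one hB, lintegral_targetLaw hρ hBm,
    hc.lintegral_selectedLaw hρ hBm]
  set g : ℕ → ℝ × 𝒵 → ℝ≥0∞ := fun k =>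
    {y : ℝ × 𝒵 | 0 < ρ y.2}.indicator fun y => ENNReal.ofReal (selLower π ρ k y.1 (ρ y.2)) with hg
  have mg : ∀ k, Measurable (g k) := fun k =>
    (measurable_selLower hρ k).ennreal_ofReal.indicator
      (measurableSet_lt measurable_const (by fun_prop))
  have gpos : ∀ k u z, 0 < ρ z → g k (u, z) = ENNReal.ofReal (selLower π ρ k u (ρ z)) :=
    fun k u z hz => indicator_of_mem (show (u, z) ∈ {y : ℝ × 𝒵 | 0 < ρ y.2} from hz) _
  have gzero : ∀ k u z, ¬ 0 < ρ z → g k (u, z) = 0 :=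
    fun k u z hz => indicator_of_notMem (fun h : (u, z) ∈ {y : ℝ × 𝒵 | 0 < ρ y.2} => hz h) _
  have e1 : ∫⁻ z, (∫⁻ u in Ioi 0, targetDensity ρ (u, z) * B.indicator 1 (u, z)) ∂π =
      ∫⁻ z, (∫⁻ u in Ioi 0, ∑' k, g k (u, z) * B.indicator 1 (u, z)) ∂π := by
    refine lintegral_congr fun z => setLIntegral_congr_fun measurableSet_Ioi fun u hu => ?_
    rw [ENNReal.tsum_mul_right]
    congr 1
    by_cases hz : 0 < ρ z
    · simp_rw [gpos _ _ _ hz]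
      rw [targetDensity_of_pos hz, tsum_selLower hρ (le_of_lt hu) hz.le]
    · simp [gzero _ _ _ hz, targetDensity_of_not_pos hz]
  have e2 : ∀ z, ∫⁻ u in Ioi 0, ∑' k, g k (u, z) * B.indicator 1 (u, z) =
      ∑' k, ∫⁻ u in Ioi 0, g k (u, z) * B.indicator 1 (u, z) := fun z =>
    lintegral_tsum fun k => by fun_prop
  rw [e1]
  simp_rw [e2]
  rw [lintegral_tsum fun k => by fun_prop]
  refine ENNReal.tsum_le_tsum fun k => hc.le_setLIntegral_selected hρ h0 k hBm ?_ fun m => ?_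
  · refine ne_top_of_le_ne_top (b := 1) (by simp) ?_
    calc _ ≤ ∫⁻ _, 1 ∂P := lintegral_mono fun ω => indicator_le_self'
            (f := (1 : ℝ × 𝒵 → ℝ≥0∞)) (fun _ _ => zero_le) _
      _ = 1 := by simp
  · refine lintegral_mono fun z => setLIntegral_mono' measurableSet_Ioi fun u hu => ?_
    refine mul_le_mul_left ?_ _
    by_cases hz : 0 < ρ z
    · rw [gpos _ _ _ hz]
      exact selLower_le_selDensity hρ h0 h1 k m hu hz
    · rw [gzero _ _ _ hz]
      exact zero_le

theorem selectedLaw_univ (hc : IsMarkedClock P π Z S) (hρ : Measurable ρ) :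
    selectedLaw P Z S ρ univ = P (⋃ k, paths Z S ⁻¹' selected ρ k) := by
  rw [measure_iUnion (fun k l hkl => (pairwise_disjoint_selected hkl).preimage _)
    fun k => hc.measurable_paths (measurableSet_selected hρ k), selectedLaw,
    Measure.sum_apply _ MeasurableSet.univ]
  refine tsum_congr fun k => ?_
  rw [Measure.map_apply ((hc.measurable_arrival _).prodMk (hc.measurable_Z _))
    MeasurableSet.univ]
  simp

theorem targetLaw_univ [SFinite π] (hρ : Measurable ρ) (h0 : ∀ z, 0 ≤ ρ z)
    (h1 : ∫⁻ z, ENNReal.ofReal (ρ z) ∂π = 1) : targetLaw π ρ univ = 1 := by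
  have := lintegral_targetLaw_mark (π := π) hρ h0 (f := fun _ => 1) measurable_const
  simpa [h1] using this

/-- A probability measure dominated by a measure of mass at most one equals it, so no upper bound on
survival is needed. -/
theorem selectedLaw_eq [IsProbabilityMeasure P] (hc : IsMarkedClock P π Z S)
    (hρ : Measurable ρ) (h0 : ∀ z, 0 ≤ ρ z) (h1 : ∫⁻ z, ENNReal.ofReal (ρ z) ∂π = 1) :
    targetLaw π ρ = selectedLaw P Z S ρ := by
  have := hc.isProbabilityMeasure_mark
  have hu := targetLaw_univ (π := π) hρ h0 h1
  have : IsProbabilityMeasure (targetLaw π ρ) := ⟨hu⟩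
  have hle := hc.targetLaw_le_selectedLaw hρ h0 h1
  refine Measure.eq_of_le_of_measure_univ_eq hle (le_antisymm (hle univ) ?_)
  rw [hu, hc.selectedLaw_univ hρ]
  exact prob_le_one

theorem ae_exists_selected [IsProbabilityMeasure P] (hc : IsMarkedClock P π Z S)
    (hρ : Measurable ρ) (h0 : ∀ z, 0 ≤ ρ z) (h1 : ∫⁻ z, ENNReal.ofReal (ρ z) ∂π = 1) :
    ∀ᵐ ω ∂P, ω ∈ ⋃ k, paths Z S ⁻¹' selected ρ k := by
  have := hc.isProbabilityMeasure_mark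
  have h := targetLaw_univ (π := π) hρ h0 h1
  rw [hc.selectedLaw_eq hρ h0 h1, hc.selectedLaw_univ hρ] at h
  exact (mem_ae_iff_prob_eq_one (MeasurableSet.iUnion fun k =>
    hc.measurable_paths (measurableSet_selected hρ k))).2 h

/-- Expected logarithm of any index bounded by the selected index. -/
theorem lintegral_log_index_le [IsProbabilityMeasure P] (hc : IsMarkedClock P π Z S)
    (hρ : Measurable ρ) (h0 : ∀ z, 0 ≤ ρ z) (h1 : ∫⁻ z, ENNReal.ofReal (ρ z) ∂π = 1)
    {J : Ω → ℕ} (hJ : ∀ᵐ ω ∂P, ∀ k, paths Z S ω ∈ selected ρ k → J ω ≤ k + 1) :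
    ∫⁻ ω, ENNReal.ofReal (Real.log (J ω)) ∂P ≤
      ∫⁻ z, ENNReal.ofReal (ρ z * Real.log (1 + ρ z)) ∂π := by
  have := hc.isProbabilityMeasure_mark
  have hlaw := hc.selectedLaw_eq hρ h0 h1
  set I : ℕ → Ω → ℝ≥0∞ := fun k ω =>
    (selected ρ k).indicator (1 : (ℕ → 𝒵) × (ℕ → ℝ) → ℝ≥0∞) (paths Z S ω) with hI
  have mI : ∀ k, Measurable (I k) := fun k => hc.measurable_selectedIndicator hρ k
  have mZ := hc.measurable_Z
  set a : 𝒵 → ℝ≥0∞ := fun z => ENNReal.ofReal (ρ z / (1 + ρ z)) with ha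
  set b : 𝒵 → ℝ≥0∞ := fun z => ENNReal.ofReal (Real.log (1 + ρ z)) with hb
  set G : 𝒵 → ℝ≥0∞ := fun z => ENNReal.ofReal (1 / (1 + ρ z)) with hGd
  have ma : Measurable a := by fun_prop
  have mb : Measurable b := by fun_prop
  have mG : Measurable G := by fun_prop
  have hG1 : ∀ z, G z ≤ 1 := fun z => by
    have := h0 z
    rw [hGd, ENNReal.ofReal_le_one, div_le_one (by positivity)]
    linarith
  have s1 : ∫⁻ ω, ENNReal.ofReal (Real.log (J ω)) ∂P ≤
      ∑' k, ∫⁻ ω, I k ω * ENNReal.ofReal (Real.log ((k + 1 : ℕ) : ℝ)) ∂P := by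
    have hU := hc.ae_exists_selected hρ h0 h1
    have hU' : (⋃ k, paths Z S ⁻¹' selected ρ k) =ᵐ[P] univ := eventuallyEq_univ.2 hU
    rw [← setLIntegral_univ, ← setLIntegral_congr hU',
      lintegral_iUnion (fun k => hc.measurable_paths (measurableSet_selected hρ k))
        fun k l hkl => (pairwise_disjoint_selected hkl).preimage _]
    refine ENNReal.tsum_le_tsum fun k => ?_
    rw [← hc.setLIntegral_selected hρ]
    refine lintegral_mono_ae ((ae_restrict_iff'
      (hc.measurable_paths (measurableSet_selected hρ k))).2 ?_)
    filter_upwards [hJ] with ω hω hk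
    refine ENNReal.ofReal_le_ofReal ?_
    have h := hω k hk
    rcases Nat.eq_zero_or_pos (J ω) with h' | h'
    · rw [h', Nat.cast_zero, Real.log_zero]
      exact Real.log_natCast_nonneg _
    · exact Real.log_le_log (by exact_mod_cast h') (by exact_mod_cast h)
  -- Jensen by hand: the tangent of `log` at `1 + ρ z`, with the negative term `a z` moved to the
  -- left to stay in `ℝ≥0∞`. It touches where the predecessor count equals its mean bound `ρ z`.
  have tangent : ∀ (k : ℕ) z, ENNReal.ofReal (Real.log ((k + 1 : ℕ) : ℝ)) + a z ≤
      b z + (k : ℝ≥0∞) * G z := by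
    intro k z
    have hz : 0 < 1 + ρ z := by linarith [h0 z]
    have hz0 := h0 z
    rw [ha, hb, hGd, ← ENNReal.ofReal_natCast, ← ENNReal.ofReal_mul (Nat.cast_nonneg k),
      ← ENNReal.ofReal_add (Real.log_natCast_nonneg _) (by positivity),
      ← ENNReal.ofReal_add (Real.log_nonneg (by linarith)) (by positivity)]
    refine ENNReal.ofReal_le_ofReal ?_
    have hk : (0 : ℝ) < ((k + 1 : ℕ) : ℝ) := by positivity
    have h := Real.log_le_sub_one_of_pos (div_pos hk hz)
    rw [Real.log_div hk.ne' hz.ne'] at h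
    have e : ((k + 1 : ℕ) : ℝ) / (1 + ρ z) - 1 = k * (1 / (1 + ρ z)) - ρ z / (1 + ρ z) := by
      push_cast
      field_simp
      ring
    linarith
  have s2 : ∑' k, ∫⁻ ω, I k ω * ENNReal.ofReal (Real.log ((k + 1 : ℕ) : ℝ)) ∂P +
      ∫⁻ z, ENNReal.ofReal (ρ z) * a z ∂π ≤ ∫⁻ z, ENNReal.ofReal (ρ z) * b z ∂π +
      ∑' k : ℕ, (k : ℝ≥0∞) * ∫⁻ ω, I k ω * G (Z (k + 1) ω) ∂P := by
    rw [← lintegral_targetLaw_mark hρ h0 ma, ← lintegral_targetLaw_mark hρ h0 mb, hlaw,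
      hc.lintegral_selectedLaw hρ (by fun_prop), hc.lintegral_selectedLaw hρ (by fun_prop),
      ← ENNReal.tsum_add, ← ENNReal.tsum_add]
    refine ENNReal.tsum_le_tsum fun k => ?_
    rw [← lintegral_const_mul' _ _ (by simp)]
    have m1 : Measurable fun ω => I k ω * ENNReal.ofReal (Real.log ((k + 1 : ℕ) : ℝ)) :=
      (mI k).mul measurable_const
    have m2 : Measurable fun ω => I k ω * b (Z (k + 1) ω) := (mI k).mul (mb.comp (mZ (k + 1)))
    refine (lintegral_add_left m1 _).ge.trans (le_trans ?_ (lintegral_add_left m2 _).le)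
    refine lintegral_mono fun ω => ?_
    have := mul_le_mul_right (tangent k (Z (k + 1) ω)) (I k ω)
    calc _ = I k ω * (ENNReal.ofReal (Real.log ((k + 1 : ℕ) : ℝ)) + a (Z (k + 1) ω)) := by
          rw [mul_add]
      _ ≤ _ := this
      _ = _ := by rw [mul_add]; congr 1; ring
  have s3 : ∑' k : ℕ, (k : ℝ≥0∞) * ∫⁻ ω, I k ω * G (Z (k + 1) ω) ∂P ≤
      ∫⁻ z, ENNReal.ofReal (ρ z) * a z ∂π := by
    -- The term without predecessors vanishes; the shift pairs winner `k + 2` with the arrival time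
    -- of winner `k + 1`.
    rw [tsum_eq_zero_add' ENNReal.summable]
    simp only [Nat.cast_zero, zero_mul, zero_add]
    calc _ ≤ ∑' k, ∫⁻ ω, I k ω * (ENNReal.ofReal (arrival (S · ω) (k + 1)) *
          G (Z (k + 1) ω)) ∂P :=
          ENNReal.tsum_le_tsum fun k => hc.succ_mul_lintegral_selected_le hρ h0 k mG hG1
      _ = ∫⁻ z, ENNReal.ofReal (ρ z) * (ENNReal.ofReal (ρ z) * G z) ∂π := by
          rw [← lintegral_targetLaw_time_mark hρ h0 mG, hlaw,
            hc.lintegral_selectedLaw hρ (by fun_prop)]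
      _ = _ := by
          refine lintegral_congr fun z => ?_
          rw [hGd, ha, ← ENNReal.ofReal_mul (h0 z), mul_one_div]
  -- The two corrections to the tangent bound cancel, which in `ℝ≥0∞` requires finiteness.
  have hfin : ∫⁻ z, ENNReal.ofReal (ρ z) * a z ∂π ≠ ∞ := by
    refine ne_top_of_le_ne_top (b := 1) (by simp) ?_
    rw [← h1]
    refine lintegral_mono fun z => mul_le_of_le_one_right zero_le ?_
    have := h0 z
    rw [ha, ENNReal.ofReal_le_one, div_le_one (by positivity)]
    linarith
  have s4 := s2.trans (add_le_add_right s3 _)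
  refine s1.trans ((ENNReal.le_of_add_le_add_right hfin s4).trans (le_of_eq ?_))
  refine lintegral_congr fun z => ?_
  rw [hb, ← ENNReal.ofReal_mul (h0 z)]

end IsMarkedClock

end IndexBound

/-! ### Comparing ordered random coding with the infinite race -/

section Coupling

open Set Filter Topology

theorem exists_orcIndex {𝒵 : Type*} {N : ℕ} (hN : 1 ≤ N) (p q : 𝒵 → ℝ≥0∞) (z : ℕ → 𝒵) (s : ℕ → ℝ) :
    ∃ n, n ∈ Finset.Icc 1 N ∧
      ∀ m ∈ Finset.Icc 1 N, orcScore N p q z s n ≤ orcScore N p q z s m :=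
  Finset.exists_min_image (Finset.Icc 1 N) (orcScore N p q z s) ⟨1, by simpa using hN⟩

theorem orcIndex_spec {𝒵 : Type*} {N : ℕ} (hN : 1 ≤ N) (p q : 𝒵 → ℝ≥0∞) (z : ℕ → 𝒵) (s : ℕ → ℝ) :
    orcIndex N p q z s ∈ Finset.Icc 1 N ∧
      ∀ m ∈ Finset.Icc 1 N, orcScore N p q z s (orcIndex N p q z s) ≤ orcScore N p q z s m :=
  Nat.sInf_mem (s := {n : ℕ | n ∈ Finset.Icc 1 N ∧
    ∀ m ∈ Finset.Icc 1 N, orcScore N p q z s n ≤ orcScore N p q z s m}) (exists_orcIndex hN p q z s)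

theorem orcTime_succ (N : ℕ) (s : ℕ → ℝ) (n : ℕ) : orcTime N s (n + 1) =
    orcTime N s n + (N : ℝ) / ((N : ℝ) - ((n + 1 : ℕ) : ℝ) + 1) * s (n + 1) := by
  simp [orcTime, Finset.sum_Icc_succ_top]

theorem arrival_pos {s : ℕ → ℝ} (hs : ∀ m, 0 < s m) {n : ℕ} (hn : 1 ≤ n) : 0 < arrival s n :=
  Finset.sum_pos (fun m _ => hs m) ⟨1, by simpa using hn⟩

theorem orcTime_le {N : ℕ} {s : ℕ → ℝ} (hs : ∀ m, 0 < s m) {k n : ℕ} (hkn : k ≤ n) (hn : n ≤ N) :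
    orcTime N s k ≤ (N : ℝ) / ((N : ℝ) - (n : ℝ) + 1) * arrival s k := by
  rw [arrival, Finset.mul_sum]
  refine Finset.sum_le_sum fun m hm => ?_
  have h1 : (m : ℝ) ≤ n := by exact_mod_cast (Finset.mem_Icc.1 hm).2.trans hkn
  have h2 : (n : ℝ) ≤ N := by exact_mod_cast hn
  have := (hs m).le
  gcongr

theorem orcTime_pos {N : ℕ} {s : ℕ → ℝ} (hs : ∀ m, 0 < s m) {n : ℕ} (h1 : 1 ≤ n) (hn : n ≤ N) :
    0 < orcTime N s n := by
  refine Finset.sum_pos (fun m hm => ?_) ⟨1, by simpa using h1⟩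
  have h2 : (m : ℝ) ≤ N := by exact_mod_cast (Finset.mem_Icc.1 hm).2.trans hn
  have h3 : (0 : ℝ) < N := by exact_mod_cast (by omega : 0 < N)
  exact mul_pos (div_pos h3 (by linarith)) (hs m)

/-- The ordered times grow faster than the unweighted arrival times. -/
theorem orcTime_mul_arrival_le {N : ℕ} {s : ℕ → ℝ} (hs : ∀ m, 0 < s m) {k j : ℕ} (hkj : k ≤ j)
    (hj : j ≤ N) : orcTime N s k * arrival s j ≤ orcTime N s j * arrival s k := by
  induction j, hkj using Nat.le_induction with
  | base => exact le_rfl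
  | succ j hkj ih =>
    have h1 := ih (by omega)
    -- The newest weight dominates all earlier ones, hence also their average `orcTime k / arrival
    -- k`.
    have h2 := mul_le_mul_of_nonneg_right (orcTime_le hs (hkj.trans j.le_succ) hj) (hs (j + 1)).le
    rw [orcTime_succ, arrival_succ]
    nlinarith

/-- Were the ordered index `j` beyond `k + 1`, multiplying the race's inequality by the monotone
ratio of the clocks would make `k + 1` a minimizer too, against the choice of the smallest one. -/
theorem orcIndex_le_of_mem_selected {𝒵 : Type*} {N : ℕ} (hN : 1 ≤ N) {p q : 𝒵 → ℝ≥0∞} {ρ : 𝒵 → ℝ}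
    (h0 : ∀ z, 0 ≤ ρ z) {w : (ℕ → 𝒵) × (ℕ → ℝ)} (hs : ∀ m, 0 < w.2 m)
    (hpq : ∀ n, p (w.1 n) / q (w.1 n) = (ENNReal.ofReal (ρ (w.1 n)))⁻¹) {k : ℕ}
    (hk : w ∈ selected ρ k) : orcIndex N p q w.1 w.2 ≤ k + 1 := by
  by_contra! hlt
  obtain ⟨hmem, hmin⟩ := orcIndex_spec hN p q w.1 w.2
  set j := orcIndex N p q w.1 w.2 with hj
  have hjN := (Finset.mem_Icc.1 hmem).2
  have hkN : k + 1 ∈ Finset.Icc 1 N := Finset.mem_Icc.2 ⟨by omega, by omega⟩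
  have hle : orcScore N p q w.1 w.2 (k + 1) ≤ orcScore N p q w.1 w.2 j := by
    have hA := (mem_selected.1 hk).2 j hlt
    have hT := orcTime_mul_arrival_le hs hlt.le hjN
    have pk := arrival_pos hs (show 1 ≤ k + 1 by omega)
    have pj := arrival_pos hs (show 1 ≤ j by omega)
    have tk := orcTime_pos hs (show 1 ≤ k + 1 by omega) (show k + 1 ≤ N by omega)
    have tj := orcTime_pos hs (show 1 ≤ j by omega) hjN
    unfold orcScore
    rw [hpq, hpq]
    rcases (h0 (w.1 j)).eq_or_lt with hz | hz
    · rw [← hz, ENNReal.ofReal_zero, ENNReal.inv_zero,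
        ENNReal.mul_top (ENNReal.ofReal_pos.2 tj).ne']
      exact le_top
    · have hzk : 0 < ρ (w.1 (k + 1)) := by
        by_contra! h
        nlinarith [mul_pos pk hz]
      rw [← ENNReal.ofReal_inv_of_pos hz, ← ENNReal.ofReal_inv_of_pos hzk,
        ← ENNReal.ofReal_mul tk.le, ← ENNReal.ofReal_mul tj.le]
      refine ENNReal.ofReal_le_ofReal ?_
      rw [← div_eq_mul_inv, ← div_eq_mul_inv, div_le_div_iff₀ hzk hz]
      refine le_of_mul_le_mul_right ?_ pj
      calc orcTime N w.2 (k + 1) * ρ (w.1 j) * arrival w.2 j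
          = (orcTime N w.2 (k + 1) * arrival w.2 j) * ρ (w.1 j) := by ring
        _ ≤ (orcTime N w.2 j * arrival w.2 (k + 1)) * ρ (w.1 j) := by gcongr
        _ = orcTime N w.2 j * (arrival w.2 (k + 1) * ρ (w.1 j)) := by ring
        _ ≤ orcTime N w.2 j * (arrival w.2 j * ρ (w.1 (k + 1))) := by gcongr
        _ = _ := by ring
  have : j ≤ k + 1 := Nat.sInf_le ⟨hkN, fun m hm => hle.trans (hmin m hm)⟩
  omega

theorem measurable_orcIndex {𝒳 𝒵 : Type*} [MeasurableSpace 𝒳] [MeasurableSpace 𝒵] {N : ℕ}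
    (hN : 1 ≤ N) {p : 𝒵 → ℝ≥0∞} (hp : Measurable p) {q : 𝒳 → 𝒵 → ℝ≥0∞}
    (hq : Measurable (Function.uncurry q)) :
    Measurable fun y : 𝒳 × (ℕ → 𝒵) × (ℕ → ℝ) => orcIndex N p (q y.1) y.2.1 y.2.2 := by
  have hscore : ∀ n, Measurable fun y : 𝒳 × (ℕ → 𝒵) × (ℕ → ℝ) =>
      orcScore N p (q y.1) y.2.1 y.2.2 n := by
    intro n
    have h1 : Measurable fun y : 𝒳 × (ℕ → 𝒵) × (ℕ → ℝ) => q y.1 (y.2.1 n) :=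
      hq.comp (f := fun y : 𝒳 × (ℕ → 𝒵) × (ℕ → ℝ) => (y.1, y.2.1 n)) (by fun_prop)
    unfold orcScore orcTime
    fun_prop
  have hm : ∀ n, MeasurableSet {y : 𝒳 × (ℕ → 𝒵) × (ℕ → ℝ) | n ∈ Finset.Icc 1 N ∧
      ∀ m ∈ Finset.Icc 1 N, orcScore N p (q y.1) y.2.1 y.2.2 n ≤
        orcScore N p (q y.1) y.2.1 y.2.2 m} := by
    intro n
    refine MeasurableSet.inter (MeasurableSet.const _) ?_
    have := Finset.measurableSet_biInter (Finset.Icc 1 N) fun m (_ : m ∈ Finset.Icc 1 N) =>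
      measurableSet_le (hscore n) (hscore m)
    refine (congrArg MeasurableSet ?_).mp this
    ext y
    simp only [mem_iInter]
    exact Iff.rfl
  have := @measurable_find _ _ _ (fun _ _ => Classical.propDecidable _) (fun y : 𝒳 × (ℕ → 𝒵) × (ℕ → ℝ) =>
    exists_orcIndex hN p (q y.1) y.2.1 y.2.2) hm
  convert! this using 1
  ext y
  exact Nat.sInf_def (exists_orcIndex hN p (q y.1) y.2.1 y.2.2)

end Coupling

/-! ### From `ρ log (1 + ρ)` to the divergence -/

section Divergence

open Set Filter Topology InformationTheory

theorem neg_exp_neg_one_le_mul_log {x : ℝ} (hx : 0 ≤ x) : -(Real.exp 1)⁻¹ ≤ x * Real.log x := by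
  rcases hx.eq_or_lt with rfl | hx
  · simp only [zero_mul, Left.neg_nonpos_iff]; positivity
  · have h := Real.log_le_sub_one_of_pos (x := (Real.exp 1 * x)⁻¹) (by positivity)
    rw [Real.log_inv, Real.log_mul (Real.exp_pos 1).ne' hx.ne', Real.log_exp, mul_inv] at h
    have := mul_le_mul_of_nonneg_left h hx.le
    have e : x * ((Real.exp 1)⁻¹ * x⁻¹ - 1) = (Real.exp 1)⁻¹ - x := by field_simp
    rw [e] at this
    linarith

/-- Use `1 + x ≤ 2` and `x log x ≥ -1 / e` for `x ≤ 1`, and `1 + x ≤ 2 * x` for `x ≥ 1`. Since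
`klFun x = x log x + 1 - x`, the extra `1` and `x` avoid subtraction when integrating. -/
theorem mul_log_one_add_le {x : ℝ} (hx : 0 ≤ x) :
    x * Real.log (1 + x) + 1 ≤ klFun x + x + Real.log 2 * x + (Real.exp 1)⁻¹ := by
  have h0 := neg_exp_neg_one_le_mul_log hx
  unfold klFun
  rcases le_total x 1 with h | h
  · have : Real.log (1 + x) ≤ Real.log 2 := Real.log_le_log (by linarith) (by linarith)
    nlinarith [mul_le_mul_of_nonneg_left this hx]
  · have : Real.log (1 + x) ≤ Real.log 2 + Real.log x := by
      rw [← Real.log_mul two_ne_zero (by linarith)]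
      exact Real.log_le_log (by linarith) (by linarith)
    have h2 : 0 < (Real.exp 1)⁻¹ := by positivity
    nlinarith [mul_le_mul_of_nonneg_left this hx]

variable {𝒵 : Type*} [MeasurableSpace 𝒵]

theorem lintegral_mul_log_one_add_le {π : Measure 𝒵} [IsProbabilityMeasure π] {ρ : 𝒵 → ℝ}
    (hρ : Measurable ρ) (h0 : ∀ z, 0 ≤ ρ z) (h1 : ∫⁻ z, ENNReal.ofReal (ρ z) ∂π = 1) :
    ∫⁻ z, ENNReal.ofReal (ρ z * Real.log (1 + ρ z)) ∂π ≤
      ∫⁻ z, ENNReal.ofReal (klFun (ρ z)) ∂π + ENNReal.ofReal ((Real.exp 1)⁻¹ + Real.log 2) := by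
  have mk : Measurable fun z => klFun (ρ z) := measurable_klFun.comp hρ
  have hl : 0 ≤ Real.log 2 := Real.log_nonneg one_le_two
  have h : ∫⁻ z, (ENNReal.ofReal (ρ z * Real.log (1 + ρ z)) + 1) ∂π ≤
      ∫⁻ z, (ENNReal.ofReal (klFun (ρ z)) + (ENNReal.ofReal (ρ z) +
        (ENNReal.ofReal (Real.log 2) * ENNReal.ofReal (ρ z) +
          ENNReal.ofReal (Real.exp 1)⁻¹))) ∂π := by
    refine lintegral_mono fun z => ?_
    have hz := h0 z
    have hk := klFun_nonneg hz
    rw [← ENNReal.ofReal_one, ← ENNReal.ofReal_mul hl,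
      ← ENNReal.ofReal_add (mul_nonneg hz (Real.log_nonneg (by linarith))) zero_le_one,
      ← ENNReal.ofReal_add (by positivity) (by positivity),
      ← ENNReal.ofReal_add (by positivity) (by positivity),
      ← ENNReal.ofReal_add (by positivity) (by positivity)]
    refine ENNReal.ofReal_le_ofReal ?_
    linarith [mul_log_one_add_le hz]
  rw [lintegral_add_right _ measurable_const, lintegral_add_left mk.ennreal_ofReal,
    lintegral_add_left (by fun_prop), lintegral_add_left (by fun_prop),
    lintegral_const_mul _ (by fun_prop), h1] at h
  simp only [lintegral_const, measure_univ, mul_one] at h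
  refine ENNReal.le_of_add_le_add_right (a := 1) (by simp) (h.trans (le_of_eq ?_))
  rw [ENNReal.ofReal_add (by positivity) hl]
  ring

variable {μ : Measure 𝒵} {p q : 𝒵 → ℝ≥0∞}

theorem isProbabilityMeasure_withDensity (h : ∫⁻ z, p z ∂μ = 1) :
    IsProbabilityMeasure (μ.withDensity p) :=
  ⟨by rw [withDensity_apply _ MeasurableSet.univ, setLIntegral_univ, h]⟩

theorem ae_withDensity_ne_zero_ne_top (hp : Measurable p) (hp1 : ∫⁻ z, p z ∂μ = 1) :
    ∀ᵐ z ∂μ.withDensity p, p z ≠ 0 ∧ p z ≠ ∞ := by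
  rw [ae_withDensity_iff hp]
  filter_upwards [ae_lt_top hp (by rw [hp1]; simp)] with z hz h
  exact ⟨h, hz.ne⟩

theorem withDensity_eq_withDensity_div (hp : Measurable p) (hp1 : ∫⁻ z, p z ∂μ = 1)
    (hq : Measurable q) (hac : μ.withDensity q ≪ μ.withDensity p) :
    μ.withDensity q = (μ.withDensity p).withDensity (fun z => q z / p z) := by
  have hz : ∀ᵐ z ∂μ.withDensity q, p z ≠ 0 ∧ p z ≠ ∞ :=
    hac.ae_le (ae_withDensity_ne_zero_ne_top hp hp1)
  rw [ae_withDensity_iff hq] at hz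
  have hd : Measurable fun z => q z / p z := hq.div hp
  rw [← withDensity_mul _ hp hd]
  refine withDensity_congr_ae ?_
  filter_upwards [hz] with z hz
  by_cases h : q z = 0
  · simp [h]
  · exact (ENNReal.mul_div_cancel (hz h).1 (hz h).2).symm

end Divergence

/-! ### Expected logarithm of the ordered index -/

section ExpectedLog

open Set Filter Topology InformationTheory

variable {Ω 𝒳 𝒵 : Type*} [MeasurableSpace Ω] [MeasurableSpace 𝒳] [MeasurableSpace 𝒵]
  {μ : Measure 𝒵} {p : 𝒵 → ℝ≥0∞} {P : Measure Ω} {Z : ℕ → Ω → 𝒵} {S : ℕ → Ω → ℝ}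

theorem ae_pos_of_map_eq_expMeasure {Y : Ω → ℝ} (hY : Measurable Y)
    (hlaw : P.map Y = expMeasure 1) : ∀ᵐ ω ∂P, 0 < Y ω := by
  refine ae_of_ae_map (f := Y) hY.aemeasurable (p := fun y => 0 < y) ?_
  rw [hlaw, ae_iff, ← lintegral_indicator_one (by measurability)]
  have := lintegral_expMeasure_add (f := {y : ℝ | ¬ 0 < y}.indicator 1)
    (measurable_one.indicator (by measurability)) 0
  simp only [zero_add] at this
  rw [this]
  refine (setLIntegral_congr_fun measurableSet_Ioi (g := fun _ => 0) fun v hv => ?_).trans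
    (by simp)
  have : v ∉ {y : ℝ | ¬ 0 < y} := fun h => h hv
  beta_reduce
  rw [indicator_of_notMem this, mul_zero]

/-- Expected logarithm of the ordered random coding index for a fixed target. -/
theorem lintegral_log_orcIndex_le [IsProbabilityMeasure P]
    (hc : IsMarkedClock P (μ.withDensity p) Z S) (hp : Measurable p) (hp1 : ∫⁻ z, p z ∂μ = 1)
    {q : 𝒵 → ℝ≥0∞} (hq : Measurable q) (hq1 : ∫⁻ z, q z ∂μ = 1) {N : ℕ} (hN : 1 ≤ N) :
    ∫⁻ ω, ENNReal.ofReal (Real.log (orcIndex N p q (paths Z S ω).1 (paths Z S ω).2)) ∂P ≤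
      klDiv (μ.withDensity q) (μ.withDensity p) +
        ENNReal.ofReal ((Real.exp 1)⁻¹ + Real.log 2) := by
  by_cases hac : μ.withDensity q ≪ μ.withDensity p
  swap
  · simp [klDiv_of_not_ac hac]
  have hπ := isProbabilityMeasure_withDensity hp1
  have hν := isProbabilityMeasure_withDensity hq1
  have hd : Measurable fun z => q z / p z := hq.div hp
  have hqd := withDensity_eq_withDensity_div hp hp1 hq hac
  have hint : ∫⁻ z, q z / p z ∂μ.withDensity p = 1 := by
    rw [← setLIntegral_univ, ← withDensity_apply _ MeasurableSet.univ, ← hqd]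
    exact measure_univ
  have htop : ∀ᵐ z ∂μ.withDensity p, q z / p z < ∞ := ae_lt_top hd (by rw [hint]; simp)
  set ρ : 𝒵 → ℝ := fun z => (q z / p z).toReal with hρd
  have hρ : Measurable ρ := hd.ennreal_toReal
  have h0 : ∀ z, 0 ≤ ρ z := fun z => ENNReal.toReal_nonneg
  have h1 : ∫⁻ z, ENNReal.ofReal (ρ z) ∂μ.withDensity p = 1 := by
    rw [← hint]
    refine lintegral_congr_ae ?_
    filter_upwards [htop] with z hz
    exact ENNReal.ofReal_toReal hz.ne
  have hkl : klDiv (μ.withDensity q) (μ.withDensity p) =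
      ∫⁻ z, ENNReal.ofReal (klFun (ρ z)) ∂μ.withDensity p := by
    rw [klDiv_eq_lintegral_klFun_of_ac hac]
    refine lintegral_congr_ae ?_
    have := Measure.rnDeriv_withDensity (μ.withDensity p) hd
    rw [← hqd] at this
    filter_upwards [this] with z hz
    rw [hz]
  rw [hkl]
  refine le_trans (hc.lintegral_log_index_le hρ h0 h1 ?_) (lintegral_mul_log_one_add_le hρ h0 h1)
  have hpos : ∀ᵐ ω ∂P, ∀ n, 0 < S n ω :=
    ae_all_iff.2 fun n => ae_pos_of_map_eq_expMeasure (hc.measurable_S n) (hc.map_S n)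
  -- Inverting `q / p` is legitimate only where `p` is neither `0` nor `∞`, which holds almost
  -- surely along the candidates; `q = 0` gives `∞` on both sides.
  have hgood : ∀ᵐ ω ∂P, ∀ n, p (Z n ω) / q (Z n ω) = (ENNReal.ofReal (ρ (Z n ω)))⁻¹ := by
    refine ae_all_iff.2 fun n => ?_
    refine ae_of_ae_map (f := Z n) (hc.measurable_Z n).aemeasurable
      (p := fun z => p z / q z = (ENNReal.ofReal (ρ z))⁻¹) ?_
    rw [hc.map_Z]
    filter_upwards [htop, ae_withDensity_ne_zero_ne_top hp hp1] with z hz hz2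
    rw [hρd, ENNReal.ofReal_toReal hz.ne, ENNReal.inv_div (Or.inl hz2.2) (Or.inl hz2.1)]
  filter_upwards [hpos, hgood] with ω hω hω2 k hk
  exact orcIndex_le_of_mem_selected hN h0 hω hω2 hk

theorem lintegral_logb_orcIndex_le [IsProbabilityMeasure P]
    (hc : IsMarkedClock P (μ.withDensity p) Z S) (hp : Measurable p) (hp1 : ∫⁻ z, p z ∂μ = 1)
    {q : 𝒵 → ℝ≥0∞} (hq : Measurable q) (hq1 : ∫⁻ z, q z ∂μ = 1) {N : ℕ} (hN : 1 ≤ N) :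
    ∫⁻ ω, ENNReal.ofReal (Real.logb 2 (orcIndex N p q (paths Z S ω).1 (paths Z S ω).2)) ∂P ≤
      klBits (μ.withDensity q) (μ.withDensity p) +
        ENNReal.ofReal ((Real.exp 1)⁻¹ * Real.logb 2 (Real.exp 1) + 1) := by
  have hl : 0 < Real.log 2 := Real.log_pos one_lt_two
  have h := lintegral_log_orcIndex_le hc hp hp1 hq hq1 hN
  have e : ∀ x : ℝ, ENNReal.ofReal (Real.logb 2 x) =
      ENNReal.ofReal (Real.log x) * (ENNReal.ofReal (Real.log 2))⁻¹ := fun x => by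
    rw [← div_eq_mul_inv, ← ENNReal.ofReal_div_of_pos hl]; rfl
  simp_rw [e]
  rw [lintegral_mul_const' _ _ (by simp [hl])]
  refine (mul_le_mul_left h _).trans (le_of_eq ?_)
  rw [add_mul, ← div_eq_mul_inv, ← div_eq_mul_inv, ← ENNReal.ofReal_div_of_pos hl, klBits]
  congr 2
  rw [Real.logb, Real.log_exp]
  field_simp

theorem lintegral_eq_lintegral_lintegral_of_indepFun {β γ : Type*} [MeasurableSpace β]
    [MeasurableSpace γ] [IsFiniteMeasure P] {X : Ω → β} {Y : Ω → γ} (hX : Measurable X)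
    (hY : Measurable Y) (h : IndepFun X Y P) {F : β → γ → ℝ≥0∞}
    (hF : Measurable (Function.uncurry F)) :
    ∫⁻ ω, F (X ω) (Y ω) ∂P = ∫⁻ ω, ∫⁻ ω', F (X ω) (Y ω') ∂P ∂P := by
  have e1 : ∫⁻ ω, F (X ω) (Y ω) ∂P =
      ∫⁻ y, Function.uncurry F y ∂P.map (fun ω => (X ω, Y ω)) :=
    (lintegral_map hF (hX.prodMk hY)).symm
  rw [e1, h.map_prod_eq_prod_map_map hX.aemeasurable hY.aemeasurable,
    lintegral_prod _ hF.aemeasurable, lintegral_map hF.lintegral_prod_right' hX]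
  exact lintegral_congr fun ω => lintegral_map hF.of_uncurry_left hY

/-- Expected logarithm of the ordered random coding index for a random target. -/
theorem lintegral_logb_orcIndex_random_le [IsProbabilityMeasure P]
    (hc : IsMarkedClock P (μ.withDensity p) Z S) (hp : Measurable p) (hp1 : ∫⁻ z, p z ∂μ = 1)
    {q : 𝒳 → 𝒵 → ℝ≥0∞} (hq : Measurable (Function.uncurry q)) (hq1 : ∀ x, ∫⁻ z, q x z ∂μ = 1)
    {X : Ω → 𝒳} (hX : Measurable X) (hXZS : IndepFun X (paths Z S) P) {N : ℕ} (hN : 1 ≤ N) :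
    ∫⁻ ω, ENNReal.ofReal
        (Real.logb 2 (orcIndex N p (q (X ω)) (paths Z S ω).1 (paths Z S ω).2)) ∂P ≤
      ∫⁻ ω, klBits (μ.withDensity (q (X ω))) (μ.withDensity p) ∂P +
        ENNReal.ofReal ((Real.exp 1)⁻¹ * Real.logb 2 (Real.exp 1) + 1) := by
  have mp := hc.measurable_paths
  have mO := measurable_orcIndex hN hp hq
  have mF : Measurable fun y : 𝒳 × (ℕ → 𝒵) × (ℕ → ℝ) =>
      ENNReal.ofReal (Real.logb 2 (orcIndex N p (q y.1) y.2.1 y.2.2)) :=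
    (Measurable.of_discrete (f := fun n : ℕ => ENNReal.ofReal (Real.logb 2 n))).comp mO
  rw [lintegral_eq_lintegral_lintegral_of_indepFun hX mp hXZS
    (F := fun x w => ENNReal.ofReal (Real.logb 2 (orcIndex N p (q x) w.1 w.2))) mF]
  refine (lintegral_mono fun ω => lintegral_logb_orcIndex_le hc hp hp1
    hq.of_uncurry_left (hq1 (X ω)) hN).trans (le_of_eq ?_)
  rw [lintegral_add_right _ measurable_const]
  simp

end ExpectedLog

/-! ### Zipf codes, Gibbs' inequality and numerical constants -/

section Zipf

theorem summable_zipf {a : ℝ} (ha : 1 < a) : Summable fun k : ℕ => ((k : ℝ) + 1) ^ (-a) := by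
  have := (Real.summable_one_div_nat_add_rpow 1 a).2 ha
  refine this.congr fun k => ?_
  rw [abs_of_nonneg (by positivity), Real.rpow_neg (by positivity), one_div]

theorem one_le_tsum_zipf {a : ℝ} (ha : 1 < a) : 1 ≤ ∑' k : ℕ, ((k : ℝ) + 1) ^ (-a) := by
  have := (summable_zipf ha).le_tsum 0 fun k _ => by positivity
  simpa using this

/-- All terms after the first are compared with the integral of `x ^ (-a)` over `[1, ∞)`. -/
theorem tsum_zipf_le {a : ℝ} (ha : 1 < a) :
    ∑' k : ℕ, ((k : ℝ) + 1) ^ (-a) ≤ 1 + 1 / (a - 1) := by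
  rw [(summable_zipf ha).tsum_eq_zero_add]
  have h0 : (((0 : ℕ) : ℝ) + 1) ^ (-a) = 1 := by simp
  rw [h0]
  refine add_le_add le_rfl (Summable.tsum_le_of_sum_range_le
    ((summable_nat_add_iff 1).2 (summable_zipf ha)) fun n => ?_)
  have hanti : AntitoneOn (fun x : ℝ => x ^ (-a)) (Set.Icc 1 (1 + n)) := by
    intro x hx y hy hxy
    exact Real.rpow_le_rpow_of_nonpos (by linarith [hx.1]) hxy (by linarith)
  have h := hanti.sum_le_integral
  rw [integral_rpow (Or.inr ⟨by linarith, fun h => by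
    rw [Set.uIcc_of_le (by simp)] at h; linarith [h.1]⟩)] at h
  have e : ∑ i ∈ Finset.range n, (((i + 1 : ℕ) : ℝ) + 1) ^ (-a) =
      ∑ i ∈ Finset.range n, (fun x : ℝ => x ^ (-a)) (1 + ((i + 1 : ℕ) : ℝ)) :=
    Finset.sum_congr rfl fun i _ => by rw [add_comm]
  rw [e]
  refine h.trans ?_
  have hp : 0 ≤ (1 + (n : ℝ)) ^ (-a + 1) := by positivity
  rw [Real.one_rpow, show -a + 1 = -(a - 1) by ring, div_neg, ← neg_div, neg_sub]
  have : 0 < a - 1 := by linarith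
  rw [show -a + 1 = -(a - 1) by ring] at hp
  gcongr
  linarith

theorem zipf_pos {a : ℝ} (ha : 1 < a) {n : ℕ} (hn : 1 ≤ n) : 0 < zipf a n := by
  have := one_le_tsum_zipf ha
  have hn' : (0 : ℝ) < n := by exact_mod_cast hn
  unfold zipf
  positivity

theorem sum_zipf_le_one {a : ℝ} (ha : 1 < a) (N : ℕ) : ∑ n ∈ Finset.Icc 1 N, zipf a n ≤ 1 := by
  have h1 := one_le_tsum_zipf ha
  unfold zipf
  rw [← Finset.sum_div, div_le_one (by linarith)]
  have e : ∑ n ∈ Finset.Icc 1 N, (n : ℝ) ^ (-a) =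
      ∑ k ∈ Finset.range N, ((k : ℝ) + 1) ^ (-a) := by
    clear h1
    induction N with
    | zero => simp
    | succ N ih => rw [Finset.sum_Icc_succ_top (by omega), Finset.sum_range_succ, ih]; simp
  rw [e]
  exact (summable_zipf ha).sum_le_tsum _ fun k _ => by positivity

theorem neg_logb_zipf {a : ℝ} (ha : 1 < a) {n : ℕ} (hn : 1 ≤ n) : -Real.logb 2 (zipf a n) =
    a * Real.logb 2 n + Real.logb 2 (∑' k : ℕ, ((k : ℝ) + 1) ^ (-a)) := by
  have h1 := one_le_tsum_zipf ha
  have hn' : (0 : ℝ) < n := by exact_mod_cast hn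
  rw [zipf, Real.logb_div (by positivity) (by linarith), Real.logb_rpow_eq_mul_logb_of_pos hn']
  ring

variable {Ω : Type*} [MeasurableSpace Ω] {P : Measure Ω} {K : Ω → ℕ}

/-- With exponent `1 + 1 / L` the logarithm of the index costs `(1 + 1 / L) * L = L + 1`, and the
normalizer is at most `1 + L`. -/
theorem expectedCodeLength_zipf_le [IsProbabilityMeasure P] (hK : Measurable K)
    (hK1 : ∀ ω, 1 ≤ K ω) {L : ℝ} (hL : 0 < L)
    (hlog : ∫⁻ ω, ENNReal.ofReal (Real.logb 2 (K ω)) ∂P ≤ ENNReal.ofReal L) :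
    expectedCodeLength P (zipf (1 + 1 / L)) K ≤
      ENNReal.ofReal (L + 1 + Real.logb 2 (1 + L)) := by
  have hL' : 0 < 1 / L := by positivity
  have ha : 1 < 1 + 1 / L := by linarith
  have h1 := one_le_tsum_zipf ha
  have h2 := tsum_zipf_le ha
  rw [add_sub_cancel_left, one_div_one_div] at h2
  have hz : 0 ≤ Real.logb 2 (∑' k : ℕ, ((k : ℝ) + 1) ^ (-(1 + 1 / L))) :=
    Real.logb_nonneg one_lt_two h1
  have hm : Measurable fun ω => ENNReal.ofReal (Real.logb 2 (K ω)) :=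
    (Measurable.of_discrete (f := fun n : ℕ => ENNReal.ofReal (Real.logb 2 n))).comp hK
  unfold expectedCodeLength
  have e : ∀ ω, ENNReal.ofReal (-Real.logb 2 (zipf (1 + 1 / L) (K ω))) =
      ENNReal.ofReal (1 + 1 / L) * ENNReal.ofReal (Real.logb 2 (K ω)) +
        ENNReal.ofReal (Real.logb 2 (∑' k : ℕ, ((k : ℝ) + 1) ^ (-(1 + 1 / L)))) := fun ω => by
    have hl : 0 ≤ Real.logb 2 (K ω) := Real.logb_nonneg one_lt_two (by exact_mod_cast hK1 ω)
    rw [neg_logb_zipf ha (hK1 ω), ENNReal.ofReal_add (by positivity) hz,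
      ENNReal.ofReal_mul (by positivity)]
  simp_rw [e]
  rw [lintegral_add_right _ measurable_const, lintegral_const_mul _ hm, lintegral_const,
    measure_univ, mul_one]
  calc _ ≤ ENNReal.ofReal (1 + 1 / L) * ENNReal.ofReal L + ENNReal.ofReal (Real.logb 2 (1 + L)) :=
        add_le_add (mul_le_mul_right hlog _)
          (ENNReal.ofReal_le_ofReal (Real.logb_le_logb_of_le one_lt_two (by linarith) h2))
    _ = _ := by
        rw [← ENNReal.ofReal_mul (by positivity), ← ENNReal.ofReal_add (by positivity)
          (Real.logb_nonneg one_lt_two (by linarith))]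
        congr 1
        field_simp

/-- Gibbs' inequality: the entropy is at most the expected ideal code length. -/
theorem entropyBits_le_expectedCodeLength [IsProbabilityMeasure P] (hK : Measurable K)
    {s : Finset ℕ} (hs : ∀ ω, K ω ∈ s) {w : ℕ → ℝ} (hw : ∀ n ∈ s, 0 < w n)
    (hsum : ∑ n ∈ s, w n ≤ 1) : entropyBits P K ≤ expectedCodeLength P w K := by
  have hl : 0 < Real.log 2 := Real.log_pos one_lt_two
  have hw1 : ∀ n ∈ s, w n ≤ 1 := fun n hn =>
    (Finset.single_le_sum (fun m hm => (hw m hm).le) hn).trans hsum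
  set f : ℕ → ℝ := fun n => P.real {ω | K ω = n} with hf
  have f0 : ∀ n, 0 ≤ f n := fun n => measureReal_nonneg
  have f1 : ∀ n, f n ≤ 1 := fun n => measureReal_le_one
  have hms : ∀ n, MeasurableSet {ω | K ω = n} := fun n => hK (measurableSet_singleton n)
  have hfs : ∑ n ∈ s, f n = 1 := by
    have h := measureReal_biUnion_finset (μ := P) (s := s) (f := fun n => {ω | K ω = n})
      (fun m _ n _ hmn => Set.disjoint_left.2 fun ω h1 h2 => hmn (Eq.trans (Eq.symm h1) h2))
      fun n _ => hms n
    refine h.symm.trans ?_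
    rw [show (⋃ n ∈ s, {ω | K ω = n}) = Set.univ from Set.eq_univ_of_forall fun ω =>
      Set.mem_biUnion (hs ω) rfl]
    exact probReal_univ
  have hE : entropyBits P K = ENNReal.ofReal (∑ n ∈ s, -(f n * Real.logb 2 (f n))) := by
    unfold entropyBits
    rw [tsum_eq_sum (s := s) fun n hn => ?_, ENNReal.ofReal_sum_of_nonneg fun n _ => ?_]
    · exact neg_nonneg.2 (mul_nonpos_of_nonneg_of_nonpos (f0 n)
        (Real.logb_nonpos one_lt_two (f0 n) (f1 n)))
    · have : {ω | K ω = n} = ∅ := Set.eq_empty_of_forall_notMem fun ω h => hn (h ▸ hs ω)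
      simp [this]
  have hC : ENNReal.ofReal (∑ n ∈ s, f n * -Real.logb 2 (w n)) ≤ expectedCodeLength P w K := by
    have e : expectedCodeLength P w K =
        ∑' n, ENNReal.ofReal (-Real.logb 2 (w n)) * P {ω | K ω = n} := by
      have := lintegral_map (μ := P) (f := fun n : ℕ => ENNReal.ofReal (-Real.logb 2 (w n)))
        Measurable.of_discrete hK
      rw [expectedCodeLength, ← this, lintegral_countable']
      refine tsum_congr fun n => ?_
      rw [Measure.map_apply hK (measurableSet_singleton n)]
      rfl
    have hn0 : ∀ n ∈ s, 0 ≤ -Real.logb 2 (w n) := fun n hn =>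
      neg_nonneg.2 (Real.logb_nonpos one_lt_two (hw n hn).le (hw1 n hn))
    rw [e, ENNReal.ofReal_sum_of_nonneg fun n hn => mul_nonneg (f0 n) (hn0 n hn)]
    refine le_trans (le_of_eq ?_) (ENNReal.sum_le_tsum s)
    refine Finset.sum_congr rfl fun n hn => ?_
    rw [mul_comm, ENNReal.ofReal_mul (hn0 n hn), hf, ofReal_measureReal]
  rw [hE]
  refine le_trans (ENNReal.ofReal_le_ofReal ?_) hC
  -- Here `log x ≤ x - 1` is taken at `w n / f n`; the linear terms sum to at most zero because `s`
  -- carries all the mass of `f`.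
  have key : ∀ n ∈ s, -(f n * Real.logb 2 (f n)) ≤
      f n * -Real.logb 2 (w n) + (w n - f n) / Real.log 2 := by
    intro n hn
    rcases (f0 n).eq_or_lt with h | h
    · rw [← h]
      have := div_nonneg (hw n hn).le hl.le
      simpa using this
    · have h2 := Real.log_le_sub_one_of_pos (div_pos (hw n hn) h)
      rw [Real.log_div (hw n hn).ne' h.ne'] at h2
      have h3 := mul_le_mul_of_nonneg_left h2 h.le
      have e3 : f n * (w n / f n - 1) = w n - f n := by field_simp
      rw [e3] at h3
      have h4 := div_le_div_of_nonneg_right h3 hl.le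
      have e4 : f n * (Real.log (w n) - Real.log (f n)) / Real.log 2 =
          f n * Real.logb 2 (w n) - f n * Real.logb 2 (f n) := by
        unfold Real.logb; field_simp
      rw [e4] at h4
      linarith
  refine (Finset.sum_le_sum key).trans ?_
  rw [Finset.sum_add_distrib, ← Finset.sum_div, Finset.sum_sub_distrib, hfs]
  have := div_nonneg (sub_nonneg.2 hsum) hl.le
  have e : (∑ n ∈ s, w n - 1) / Real.log 2 = -((1 - ∑ n ∈ s, w n) / Real.log 2) := by
    rw [← neg_div]; ring
  rw [e]
  linarith

theorem inv_exp_mul_logb_exp_lt : (Real.exp 1)⁻¹ * Real.logb 2 (Real.exp 1) < 0.54 := by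
  have h1 := Real.exp_one_gt_d9
  have h2 := Real.log_two_gt_d9
  rw [Real.logb, Real.log_exp, ← div_eq_inv_mul, div_div, div_lt_iff₀ (by positivity)]
  nlinarith

/-- From `C + 2.54 ≤ 2.54 * (C + 1)` and `2.54 ^ 5 ≤ 2 ^ 7` the constants add up to at most `2.54 +
1.4 < 4`. -/
theorem codeLength_bound_lt {C : ℝ} (hC : 0 ≤ C) {L : ℝ} (hL0 : 0 < L) (hL : L < C + 1.54) :
    L + 1 + Real.logb 2 (1 + L) < C + Real.logb 2 (C + 1) + 4 := by
  have h1 : Real.logb 2 (1 + L) ≤ Real.logb 2 ((C + 1) * 2.54) :=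
    Real.logb_le_logb_of_le one_lt_two (by linarith) (by linarith)
  rw [Real.logb_mul (by linarith) (by norm_num)] at h1
  have h2 : Real.logb 2 2.54 ≤ 7 / 5 := by
    have h : Real.logb 2 ((2.54 : ℝ) ^ 5) ≤ Real.logb 2 ((2 : ℝ) ^ 7) :=
      Real.logb_le_logb_of_le one_lt_two (by norm_num) (by norm_num)
    rw [Real.logb_pow, Real.logb_pow, Real.logb_self_eq_one one_lt_two] at h
    push_cast at h
    linarith
  linarith

/-- Entropy and Zipf code length of an index whose expected logarithm is bounded. -/
theorem entropyBits_lt_and_expectedCodeLength_lt [IsProbabilityMeasure P] (hK : Measurable K)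
    {N : ℕ} (hKs : ∀ ω, K ω ∈ Finset.Icc 1 N) {C : ℝ} (hC : 0 ≤ C)
    (hlog : ∫⁻ ω, ENNReal.ofReal (Real.logb 2 (K ω)) ∂P ≤
      ENNReal.ofReal (C + (Real.exp 1)⁻¹ * Real.logb 2 (Real.exp 1) + 1)) :
    entropyBits P K < ENNReal.ofReal (C + Real.logb 2 (C + 1) + 4) ∧
    expectedCodeLength P
        (zipf (1 + 1 / (C + (Real.exp 1)⁻¹ * Real.logb 2 (Real.exp 1) + 1))) K <
      ENNReal.ofReal (C + Real.logb 2 (C + 1) + 4) := by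
  have hlogb : 0 < Real.logb 2 (Real.exp 1) :=
    Real.logb_pos one_lt_two (Real.one_lt_exp_iff.2 one_pos)
  have hLC : C + (Real.exp 1)⁻¹ * Real.logb 2 (Real.exp 1) + 1 < C + 1.54 := by
    have := inv_exp_mul_logb_exp_lt
    norm_num at this ⊢
    linarith
  have hL : 0 < C + (Real.exp 1)⁻¹ * Real.logb 2 (Real.exp 1) + 1 := by positivity
  generalize C + (Real.exp 1)⁻¹ * Real.logb 2 (Real.exp 1) + 1 = L at hlog hLC hL ⊢
  have hcode := expectedCodeLength_zipf_le hK (fun ω => (Finset.mem_Icc.1 (hKs ω)).1) hL hlog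
  have ha : 1 < 1 + 1 / L := lt_add_of_pos_right _ (by positivity)
  have hlt : ENNReal.ofReal (L + 1 + Real.logb 2 (1 + L)) <
      ENNReal.ofReal (C + Real.logb 2 (C + 1) + 4) := by
    have h1 : 0 ≤ Real.logb 2 (C + 1) := Real.logb_nonneg one_lt_two (by linarith)
    exact (ENNReal.ofReal_lt_ofReal_iff (by positivity)).2 (codeLength_bound_lt hC hL hLC)
  refine ⟨lt_of_le_of_lt ?_ hlt, lt_of_le_of_lt hcode hlt⟩
  exact (entropyBits_le_expectedCodeLength hK hKs
    (fun n hn => zipf_pos ha (Finset.mem_Icc.1 hn).1) (sum_zipf_le_one ha N)).trans hcode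

end Zipf

end ReverseChannelCoding

theorem corollary4
    {Ω 𝒳 𝒵 : Type*} [MeasurableSpace Ω] [MeasurableSpace 𝒳] [MeasurableSpace 𝒵]
    -- reference measure, proposal density `p` and target densities `q x`
    (μ : Measure 𝒵) [SFinite μ]
    (p : 𝒵 → ℝ≥0∞) (hp : Measurable p) (hp_one : ∫⁻ z, p z ∂μ = 1)
    (q : 𝒳 → 𝒵 → ℝ≥0∞) (hq : Measurable (Function.uncurry q))
    (hq_one : ∀ x, ∫⁻ z, q x z ∂μ = 1)
    -- source `X`, candidates `Z n ~ p` and rate-one exponential variables `S n`, all independent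
    (P : Measure Ω) [IsProbabilityMeasure P]
    (X : Ω → 𝒳) (hX : Measurable X)
    (Z : ℕ → Ω → 𝒵) (hZ : ∀ n, Measurable (Z n))
    (hZ_law : ∀ n, P.map (Z n) = μ.withDensity p) (hZ_indep : iIndepFun Z P)
    (S : ℕ → Ω → ℝ) (hS : ∀ n, Measurable (S n))
    (hS_law : ∀ n, P.map (S n) = expMeasure 1) (hS_indep : iIndepFun S P)
    (hZS : IndepFun (fun ω n => Z n ω) (fun ω n => S n ω) P)
    (hXZS : IndepFun X (fun ω => ((fun n => Z n ω), (fun n => S n ω))) P)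
    -- `C = E[D(q_X ‖ p)]` in bits, finite
    (C : ℝ≥0)
    (hC : ∫⁻ ω, ReverseChannelCoding.klBits (μ.withDensity (q (X ω))) (μ.withDensity p) ∂P = C)
    -- number of candidates
    (N : ℕ) (hN : 1 ≤ N) :
    ReverseChannelCoding.entropyBits P
        (fun ω => ReverseChannelCoding.orcIndex N p (q (X ω)) (fun n => Z n ω) (fun n => S n ω))
      < ENNReal.ofReal ((C : ℝ) + Real.logb 2 ((C : ℝ) + 1) + 4) ∧
    ReverseChannelCoding.expectedCodeLength P
        (ReverseChannelCoding.zipf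
          (1 + 1 / ((C : ℝ) + (Real.exp 1)⁻¹ * Real.logb 2 (Real.exp 1) + 1)))
        (fun ω => ReverseChannelCoding.orcIndex N p (q (X ω)) (fun n => Z n ω) (fun n => S n ω))
      < ENNReal.ofReal ((C : ℝ) + Real.logb 2 ((C : ℝ) + 1) + 4) := by
  have hc : ReverseChannelCoding.IsMarkedClock P (μ.withDensity p) Z S :=
    ⟨hZ, hZ_law, hZ_indep, hS, hS_law, hS_indep, hZS⟩
  have hlog := ReverseChannelCoding.lintegral_logb_orcIndex_random_le hc hp hp_one hq hq_one hX
    hXZS hN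
  have hconst : 0 ≤ (Real.exp 1)⁻¹ * Real.logb 2 (Real.exp 1) + 1 := by
    have : 0 ≤ Real.logb 2 (Real.exp 1) :=
      Real.logb_nonneg one_lt_two (Real.one_le_exp zero_le_one)
    positivity
  rw [hC, ← ENNReal.ofReal_coe_nnreal, ← ENNReal.ofReal_add C.coe_nonneg hconst,
    ← add_assoc] at hlog
  exact ReverseChannelCoding.entropyBits_lt_and_expectedCodeLength_lt
    ((ReverseChannelCoding.measurable_orcIndex hN hp hq).comp (hX.prodMk hc.measurable_paths))
    (fun ω => (ReverseChannelCoding.orcIndex_spec hN p (q (X ω)) _ _).1) C.coe_nonneg hlog
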